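/- **Setting.** Let $\mathcal X\subset\mathbb R^d$ be compact and nonempty, and let $k:\mathbb R^d\times\mathbb R^d\to\mathbb R$ be a continuous, symmetric, positive semidefinite kernel with $k(x,x')\le 1$ for $x,x'\in\mathcal X$ and RKHS $\mathcal H_k$. Let $\mathcal B_f=\{g\in\mathcal H_k:\|g\|_k\le B\}$ with $B\ge 0$, let $f\in\mathcal B_f$, and let $x^\star\in\arg\max_{\mathcal X}f$. Let $\lambda>0$, $\delta\in(0,1)$ and $T\ge1$. Put $\sigma(u)=1/(1+e^{-u})$. Let $\mathcal N(\mathcal B_f,\epsilon,\|\cdot\|_\infty)$ be the least number of closed balls of radius $\epsilon$ in the norm $\|g\|_\infty=\sup_{x\in\mathcal X}|g(x)|$, centred in $\mathcal B_f$, that cover $\mathcal B_f$; write $N_\epsilon$ for it. **Constants.** Let $\underline\sigma=\frac1{1+e^{2B}}$, $\bar\sigma=\frac1{1+e^{-2B}}$, $\underline{\sigma}'=\frac{1}{2+e^{2B}+e^{-2B}}$, $\bar\sigma'=\frac14$, $B_p=\frac{\bar\sigma}{\underline\sigma}-\frac{\underline\sigma}{\bar\sigma}$, $H_\sigma=\frac1{2\bar\sigma^2}$,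 $C_L=1+\frac{2}{1+e^{-2B}}$, and $$\beta_1(\epsilon,\delta,t)=\sqrt{32tB^2\log\tfrac{\pi^2t^2N_\epsilon}{6\delta}}+C_L\epsilon t,$$ $$\beta_2(\epsilon,\delta,t)=8H_\sigma\bar\sigma'^2\epsilon^2t+2C_L\epsilon t+\sqrt{8tB_p^2\log\tfrac{\pi^2t^2N_\epsilon}{3\delta}},$$ $$\beta(\epsilon,\delta,t)=\frac{1}{\underline\sigma'^2H_\sigma}\bigl(\beta_2(\epsilon,\delta,t)+2\beta_1(\epsilon,\delta,t)\bigr),\qquad \beta_T=\beta(1/T,\delta,T).$$ **Information gain.** Let $k^{ff'}((x,x'),(y,y'))=k(x,y)+k(x',y')$ and $$\gamma_T^{ff'}=\max_{\omega_1,\dots,\omega_T\in\mathcal X\times\mathcal X}\tfrac12\log\det\bigl(I+\lambda^{-1}(k^{ff'}(\omega_i,\omega_j))_{i,j\le T}\bigr),$$ where repetitions among the $\omega_i$ are allowed. **Algorithm (POP-BO).** Start from $x_0\in\mathcal X$ and $\mathcal B_f^1=\mathcal B_f$. In step $t=1,\dots,T$ set $x_t'=x_{t-1}$, and choose $x_t\in\mathcal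 X$ and $\tilde f_t\in\mathcal B_f^t$ that jointly maximize $\tilde f(x)-\tilde f(x_t')$ over $x\in\mathcal X$, $\tilde f\in\mathcal B_f^t$. Then observe $\mathbf 1_t\in\{0,1\}$, which, conditionally on the past (including the algorithm's own randomness), equals $1$ with probability $\sigma(f(x_t)-f(x_t'))$. Put $\mathcal B_f^{t+1}=\{g\in\mathcal B_f:\ell_t(g)\ge\ell_t(\hat f_t)-\beta_1(1/T,\eta,t)\}$, where $\ell_t(g)=\sum_{\tau\le t}\log\bigl(\mathbf 1_\tau\sigma(g(x_\tau)-g(x'_\tau))+(1-\mathbf 1_\tau)(1-\sigma(g(x_\tau)-g(x_\tau')))\bigr)$ and $\hat f_t$ maximizes $\ell_t$ over $\mathcal B_f$. The confidence parameter is any $\eta\in[\delta/2,\delta]$. **Theorem (Cumulative Regret Bound).** There is a constant $C>0$ that depends only on $B$ and $\lambda$ such that, in this setting, $N_{1/T}<\infty$, the maximum defining $\gamma_T^{ff'}$ is attained, and $$\mathbb P\Bigl(R_T=\sum_{t=1}^T\bigl(f(x^\star)-f(x_t)\bigr)\le C\sqrt{\beta_T\,\gamma_T^{ff'}\,T}\Bigr)\ge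 1-\delta;$$ moreover, if $T\ge2$, $$\beta_T\le C\sqrt{T\log\frac{T\,\mathcal N(\mathcal B_f,1/T,\|\cdot\|_\infty)}{\delta}}.$$ -/

import Mathlib

open MeasureTheory ProbabilityTheory Set
open scoped NNReal ENNReal

namespace POPBO

noncomputable section

/-- Points of the input space `ℝ^d`. -/
abbrev Pt (d : ℕ) : Type := EuclideanSpace ℝ (Fin d)

section RKHSpart

/-- `H` is the reproducing kernel Hilbert space of the real-valued kernel `k`. (Kernels of a `RKHS`
in Mathlib are operator-valued; over `ℝ` the operator `ℝ →L[ℝ] ℝ` is read off at `1`.) -/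
def IsRKHSOf {d : ℕ} (H : Type*) [NormedAddCommGroup H] [InnerProductSpace ℝ H] [CompleteSpace H]
    [RKHS ℝ H (Pt d) ℝ] (k : Pt d → Pt d → ℝ) : Prop :=
  ∀ x y, RKHS.kernel H x y 1 = k x y

/-- The ball `{g ∈ H | ‖g‖ ≤ B}` of candidate functions. -/
def fball (H : Type*) [NormedAddCommGroup H] (B : ℝ) : Set H := {g | ‖g‖ ≤ B}

/-- Covering number of the ball of radius `B` of `H` for the supremum norm on `X`:
the least number of closed sup-norm balls of radius `ε`, with centres in the ball of `H`, that
cover the ball of `H`. Elements of `H` are viewed as functions on `X`, and `X →ᵤ ℝ` carries the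
distance `⨆ x, |g x - h x|`. -/
def covNum {d : ℕ} (H : Type*) [NormedAddCommGroup H] [InnerProductSpace ℝ H]
    [RKHS ℝ H (Pt d) ℝ] (X : Set (Pt d)) (B : ℝ) (ε : ℝ) : ℕ∞ :=
  Metric.coveringNumber ε.toNNReal
    ((fun g : H => (UniformFun.ofFun (fun x : X => g (x : Pt d)) : UniformFun X ℝ)) '' fball H B)

end RKHSpart

section Constants

/-- Lower bound of the link function on `[-2B, 2B]`. -/
def sigLow (B : ℝ) : ℝ := 1 / (1 + Real.exp (2 * B))

/-- Upper bound of the link function on `[-2B, 2B]`. -/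
def sigUp (B : ℝ) : ℝ := 1 / (1 + Real.exp (-2 * B))

/-- Lower bound of the derivative of the link function on `[-2B, 2B]`. -/
def dsigLow (B : ℝ) : ℝ := 1 / (2 + Real.exp (2 * B) + Real.exp (-2 * B))

/-- Upper bound of the derivative of the link function. -/
def dsigUp : ℝ := 1 / 4

def constBp (B : ℝ) : ℝ := sigUp B / sigLow B - sigLow B / sigUp B

def constH (B : ℝ) : ℝ := 1 / (2 * sigUp B ^ 2)

def constCL (B : ℝ) : ℝ := 1 + 2 / (1 + Real.exp (-2 * B))

/-- Width `β₁(ε, δ, t)` of the likelihood confidence set; `N` is the covering number at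
radius `ε`. -/
def beta1 (B N ε δ : ℝ) (t : ℕ) : ℝ :=
  Real.sqrt (32 * t * B ^ 2 * Real.log (Real.pi ^ 2 * t ^ 2 * N / (6 * δ))) + constCL B * ε * t

/-- `β₂(ε, δ, t)`. -/
def beta2 (B N ε δ : ℝ) (t : ℕ) : ℝ :=
  8 * constH B * dsigUp ^ 2 * ε ^ 2 * t + 2 * constCL B * ε * t
    + Real.sqrt (8 * t * constBp B ^ 2 * Real.log (Real.pi ^ 2 * t ^ 2 * N / (3 * δ)))

/-- `β(ε, δ, t)`, the radius of the elliptical bound. -/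
def beta (B N ε δ : ℝ) (t : ℕ) : ℝ :=
  1 / (dsigLow B ^ 2 * constH B) * (beta2 B N ε δ t + 2 * beta1 B N ε δ t)

end Constants

section InformationGain

/-- The additive kernel `k((x, x'), (y, y')) = k(x, y) + k(x', y')` on pairs. -/
def pairKernel {d : ℕ} (k : Pt d → Pt d → ℝ) (w v : Pt d × Pt d) : ℝ := k w.1 v.1 + k w.2 v.2

/-- The information gain `1/2 log det (I + λ⁻¹ K)` of a sequence of `T` pairs. -/
def infoGain {d : ℕ} (k : Pt d → Pt d → ℝ) (lam : ℝ) {T : ℕ} (w : Fin T → Pt d × Pt d) : ℝ :=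
  1 / 2 * Real.log
    (1 + lam⁻¹ • (Matrix.of fun i j => pairKernel k (w i) (w j)) : Matrix (Fin T) (Fin T) ℝ).det

/-- The information gains of all sequences of `T` pairs from `X × X` (repetitions allowed). -/
def infoGains {d : ℕ} (k : Pt d → Pt d → ℝ) (X : Set (Pt d)) (lam : ℝ) (T : ℕ) : Set ℝ :=
  {r | ∃ w : Fin T → Pt d × Pt d, (∀ i, w i ∈ X ×ˢ X) ∧ r = infoGain k lam w}

/-- The maximum information gain `γ_T`. -/
def maxInfoGain {d : ℕ} (k : Pt d → Pt d → ℝ) (X : Set (Pt d)) (lam : ℝ) (T : ℕ) : ℝ :=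
  sSup (infoGains k X lam T)

end InformationGain

section Likelihood

/-- The likelihood of one comparison of `x` and `x'` with outcome `b` (`true`: `x` is preferred),
under the Bernoulli model with utility `g`. -/
def lik {d : ℕ} (g : Pt d → ℝ) (x x' : Pt d) (b : Bool) : ℝ :=
  if b then Real.sigmoid (g x - g x') else 1 - Real.sigmoid (g x - g x')

/-- The log-likelihood of `g` on the comparisons of the steps `1, …, t`. -/
def logLik {d : ℕ} (g : Pt d → ℝ) (x x' : ℕ → Pt d) (o : ℕ → Bool) (t : ℕ) : ℝ :=
  ∑ τ ∈ Finset.Icc 1 t, Real.log (lik g (x τ) (x' τ) (o τ))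

/-- The confidence set built from the comparisons of the steps `1, …, t`, that is, the set used by
the algorithm in step `t + 1`. Without data it is the whole ball; otherwise it consists of the
functions of the ball whose log-likelihood is at most `β₁(ε, η, t)` below that of the maximum
likelihood estimator `fmle`. -/
def confSet {d : ℕ} {H : Type*} [NormedAddCommGroup H] [InnerProductSpace ℝ H]
    [RKHS ℝ H (Pt d) ℝ] (X : Set (Pt d)) (B ε η : ℝ) (x x' : ℕ → Pt d) (o : ℕ → Bool)
    (fmle : H) (t : ℕ) : Set H :=
  if t = 0 then fball H B else
    {g | g ∈ fball H B ∧
      logLik (fmle : Pt d → ℝ) x x' o t - beta1 B (covNum H X B ε).toNat ε η t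
        ≤ logLik (g : Pt d → ℝ) x x' o t}

end Likelihood

section Processes

/-- The comparison oracle with utility `f` over the steps `1, …, T`, relative to the filtration `ℱ`:
the duel `(x t, x' t)` is known at time `t - 1`, the outcome `o t` at time `t`, and, given the past,
`x t` is preferred to `x' t` with probability `σ(f (x t) - f (x' t))`. Any internal randomness with
which the duel `(x t, x' t)` was chosen is part of `ℱ (t - 1)`. -/
structure IsOracle {d : ℕ} {Ω : Type*} [mΩ : MeasurableSpace Ω] (μ : Measure Ω)
    (ℱ : Filtration ℕ mΩ) (f : Pt d → ℝ) (T : ℕ) (x x' : ℕ → Ω → Pt d) (o : ℕ → Ω → Bool) :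
    Prop where
  duel_left : ∀ t ∈ Finset.Icc 1 T, Measurable[ℱ (t - 1)] (x t)
  duel_right : ∀ t ∈ Finset.Icc 1 T, Measurable[ℱ (t - 1)] (x' t)
  outcome : ∀ t ∈ Finset.Icc 1 T, Measurable[ℱ t] (o t)
  bernoulli : ∀ t ∈ Finset.Icc 1 T,
    μ[{ω | o t ω = true}.indicator (fun _ => (1 : ℝ)) | ℱ (t - 1)]
      =ᵐ[μ] fun ω => Real.sigmoid (f (x t ω) - f (x' t ω))

/-- The sequences `x`, `x'`, `o`, `mle` (queried points, reference points, outcomes, maximum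
likelihood estimators) form a run of the algorithm over the horizon `T`, with confidence sets of
parameters `ε`, `η`. -/
structure IsRun {d : ℕ} {H : Type*} [NormedAddCommGroup H] [InnerProductSpace ℝ H]
    [RKHS ℝ H (Pt d) ℝ] (X : Set (Pt d)) (B ε η : ℝ) (T : ℕ)
    (x x' : ℕ → Pt d) (o : ℕ → Bool) (mle : ℕ → H) : Prop where
  init : x 0 ∈ X
  reference : ∀ t ∈ Finset.Icc 1 T, x' t = x (t - 1)
  /-- `x t` maximizes, jointly with some function `g` of the current confidence set,
  the optimistic advantage over the reference point. -/
  optimistic : ∀ t ∈ Finset.Icc 1 T, x t ∈ X ∧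
    ∃ g ∈ confSet X B ε η x x' o (mle (t - 1)) (t - 1),
      ∀ z ∈ X, ∀ h ∈ confSet X B ε η x x' o (mle (t - 1)) (t - 1),
        h z - h (x' t) ≤ g (x t) - g (x' t)
  mle_mem : ∀ t ∈ Finset.Icc 1 T, mle t ∈ fball H B
  mle_max : ∀ t ∈ Finset.Icc 1 T, ∀ h ∈ fball H B,
    logLik (h : Pt d → ℝ) x x' o t ≤ logLik (mle t : Pt d → ℝ) x x' o t

/-- The cumulative regret `R_T`, where `xstar` is a maximizer of `f`. -/
def regret {d : ℕ} (f : Pt d → ℝ) (xstar : Pt d) (x : ℕ → Pt d) (T : ℕ) : ℝ :=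
  ∑ t ∈ Finset.Icc 1 T, (f xstar - f (x t))

end Processes

end

end POPBO

namespace POPBO

/-! ### Elementary inequalities for the logistic link -/

/-! For a candidate g, let D_τ be its advantage in duel τ minus that of f. The log-likelihood ratio
of g against f in one duel is affine in the outcome, with slope D_τ. Replacing the outcome by its
conditional mean leaves minus a relative entropy, at most -(σ'²/2) D_τ² with σ' = `dsigLow B`. So
the ratio is at most a martingale increment minus a quadratic drift (`log_lik_sub_le`).

The martingale has increments of size at most 4B. A Chernoff bound (`measure_noise_ge_le`), united
over all times and the centres of a finite sup-norm cover of the ball, keeps it below the root term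
of β₁ except with probability η (`measure_concentrates_ge`). The cover is finite by Arzelà–Ascoli
(`totallyBounded_fball`).

On this one event f lies in every confidence set (`logLik_le_add_beta1`). The drift also forces
every member g to satisfy ∑ D_τ² = O(β₁) on the past duels (`sum_sq_le_of_logLik_ge`).

Optimism bounds the regret of step t by the advantage of g - f in duel t, for some member g of the
current confidence set. Advantages are inner products in H × H with the features of the additive
kernel. A function small in norm and on the past duels has a small advantage in the new one, unless
that duel enlarges the Gram determinant; summation gives the bound by the information gain
(`sq_sum_inner_le_log_det`). Only β₁ arises in this argument; β dominates it. -/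

lemma log_sigmoid_le_add {u v : ℝ} (h : u ≤ v) :
    Real.log (Real.sigmoid v) ≤ Real.log (Real.sigmoid u) + (v - u) := by
  have hu := Real.sigmoid_pos u
  have hv := Real.sigmoid_pos v
  have key : Real.sigmoid v ≤ Real.sigmoid u * Real.exp (v - u) := by
    rw [Real.sigmoid_def, Real.sigmoid_def, ← div_eq_inv_mul, inv_eq_one_div,
      div_le_div_iff₀ (by positivity) (by positivity)]
    have h1 : Real.exp (v - u) * (1 + Real.exp (-v)) = Real.exp (v - u) + Real.exp (-u) := by
      rw [mul_add, mul_one, ← Real.exp_add]; ring_nf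
    have h2 : 1 ≤ Real.exp (v - u) := Real.one_le_exp (by linarith)
    linarith
  calc Real.log (Real.sigmoid v) ≤ Real.log (Real.sigmoid u * Real.exp (v - u)) :=
        Real.log_le_log hv key
    _ = _ := by rw [Real.log_mul hu.ne' (Real.exp_pos _).ne', Real.log_exp]

/-- The derivative of log σ is 1 - σ, which lies in (0, 1). -/
lemma abs_log_sigmoid_sub_le (u v : ℝ) :
    |Real.log (Real.sigmoid u) - Real.log (Real.sigmoid v)| ≤ |u - v| := by
  wlog h : u ≤ v generalizing u v
  · rw [abs_sub_comm, abs_sub_comm u]; exact this v u (le_of_not_ge h)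
  have h1 := log_sigmoid_le_add h
  have h2 := Real.log_le_log (Real.sigmoid_pos u) (Real.sigmoid_le h)
  rw [abs_of_nonpos (by linarith), abs_of_nonpos (by linarith)]
  linarith

lemma log_sigmoid_sub_log_one_sub (u : ℝ) :
    Real.log (Real.sigmoid u) - Real.log (1 - Real.sigmoid u) = u := by
  rw [← Real.sigmoid_neg, ← Real.sigmoid_mul_rexp_neg,
    Real.log_mul (Real.sigmoid_pos u).ne' (Real.exp_pos _).ne', Real.log_exp]
  ring

/-- Since 1 - σ(u) = σ(-u), the two outcomes differ by a sign only and share one Lipschitz estimate.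
-/
lemma lik_eq_sigmoid {d : ℕ} (g : Pt d → ℝ) (x x' : Pt d) (b : Bool) :
    lik g x x' b = Real.sigmoid (if b then g x - g x' else -(g x - g x')) := by
  cases b
  · simp only [lik, Bool.false_eq_true, if_false, Real.sigmoid_neg]
  · simp only [lik, if_true]

lemma abs_log_lik_sub_le {d : ℕ} (g h : Pt d → ℝ) (x x' : Pt d) (b : Bool) :
    |Real.log (lik g x x' b) - Real.log (lik h x x' b)|
      ≤ |(g x - g x') - (h x - h x')| := by
  rw [lik_eq_sigmoid, lik_eq_sigmoid]
  refine (abs_log_sigmoid_sub_le _ _).trans ?_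
  cases b
  · simp only [Bool.false_eq_true, if_false]
    rw [abs_sub_comm]; apply le_of_eq; congr 1; ring
  · simp

/-- The negative relative entropy of two Bernoulli laws is at most `-(p - q)² / 2`. -/
lemma bernoulli_drift_le {p q : ℝ} (hp0 : 0 < p) (hp1 : p < 1) (hq0 : 0 < q) (hq1 : q < 1) :
    p * (Real.log q - Real.log p) + (1 - p) * (Real.log (1 - q) - Real.log (1 - p))
      ≤ -(p - q) ^ 2 / 2 := by
  -- With a = α² and b = β², log x ≤ x - 1 at x = β/α gives b - a - (α - β)², a Hellinger term; α +
  -- β ≤ 2 then bounds (a - b)²/4 by (α - β)². When the two outcomes are added, the linear parts b -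
  -- a cancel.
  have aux : ∀ a b : ℝ, 0 < a → 0 < b → a < 1 → b < 1 →
      a * (Real.log b - Real.log a) ≤ b - a - (a - b) ^ 2 / 4 := by
    intro a b ha hb ha1 hb1
    obtain ⟨α, hα, rfl⟩ : ∃ α, 0 < α ∧ a = α ^ 2 :=
      ⟨√a, Real.sqrt_pos.2 ha, (Real.sq_sqrt ha.le).symm⟩
    obtain ⟨β, hβ, rfl⟩ : ∃ β, 0 < β ∧ b = β ^ 2 :=
      ⟨√b, Real.sqrt_pos.2 hb, (Real.sq_sqrt hb.le).symm⟩
    have hα1 : α < 1 := by nlinarith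
    have hβ1 : β < 1 := by nlinarith
    have h1 : Real.log (β / α) ≤ β / α - 1 := Real.log_le_sub_one_of_pos (by positivity)
    rw [Real.log_div hβ.ne' hα.ne'] at h1
    rw [Real.log_pow, Real.log_pow]
    have h2 : α ^ 2 * (((2 : ℕ) : ℝ) * Real.log β - ((2 : ℕ) : ℝ) * Real.log α)
        ≤ α ^ 2 * (2 * (β / α - 1)) := by
      apply mul_le_mul_of_nonneg_left _ (by positivity); push_cast; linarith
    have h3 : α ^ 2 * (2 * (β / α - 1)) = 2 * α * β - 2 * α ^ 2 := by field_simp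
    have h4 : (α ^ 2 - β ^ 2) ^ 2 / 4 ≤ (α - β) ^ 2 := by
      have : (α ^ 2 - β ^ 2) ^ 2 / 4 = (α - β) ^ 2 * ((α + β) / 2) ^ 2 := by ring
      rw [this]
      refine mul_le_of_le_one_right (sq_nonneg _) ?_
      exact pow_le_one₀ (by positivity) (by linarith)
    nlinarith
  have h1 := aux p q hp0 hq0 hp1 hq1
  have h2 := aux (1 - p) (1 - q) (by linarith) (by linarith) (by linarith) (by linarith)
  have h3 : (1 - p - (1 - q)) ^ 2 = (p - q) ^ 2 := by ring
  rw [h3] at h2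
  linarith

lemma dsigLow_pos (B : ℝ) : 0 < dsigLow B := by unfold dsigLow; positivity

/-- σ'(u) = 1 / (2 + 2 cosh u), and cosh grows with |u|, so the minimum over [-2B, 2B] is at the
endpoints. -/
lemma dsigLow_le_deriv_sigmoid {B u : ℝ} (hB : 0 ≤ B) (hu : |u| ≤ 2 * B) :
    dsigLow B ≤ Real.sigmoid u * (1 - Real.sigmoid u) := by
  have h1 : Real.sigmoid u * (1 - Real.sigmoid u) = 1 / (2 + Real.exp u + Real.exp (-u)) := by
    rw [← Real.sigmoid_neg, Real.sigmoid_def, Real.sigmoid_def, ← mul_inv, one_div, neg_neg]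
    congr 1
    have : Real.exp u * Real.exp (-u) = 1 := by rw [← Real.exp_add]; simp
    nlinarith
  rw [h1, dsigLow]
  have h2 : Real.cosh u ≤ Real.cosh (2 * B) := by
    rw [Real.cosh_le_cosh, abs_of_nonneg (by linarith : 0 ≤ 2 * B)]; exact hu
  rw [Real.cosh_eq, Real.cosh_eq] at h2
  refine one_div_le_one_div_of_le (by positivity) ?_
  rw [neg_mul]
  linarith

lemma dsigLow_mul_abs_le {B u v : ℝ} (hB : 0 ≤ B) (hu : |u| ≤ 2 * B) (hv : |v| ≤ 2 * B) :
    dsigLow B * |u - v| ≤ |Real.sigmoid u - Real.sigmoid v| := by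
  wlog h : u ≤ v generalizing u v
  · rw [abs_sub_comm, abs_sub_comm (Real.sigmoid u)]; exact this hv hu (le_of_not_ge h)
  have hmv := (convex_Icc (-(2 * B)) (2 * B)).mul_sub_le_image_sub_of_le_deriv
    (f := Real.sigmoid) (C := dsigLow B) continuous_sigmoid.continuousOn
    differentiable_sigmoid.differentiableOn
    (fun x hx => by
      rw [Real.deriv_sigmoid]
      exact dsigLow_le_deriv_sigmoid hB (abs_le.2 (mem_Icc.1 (interior_subset hx))))
    u (abs_le.1 hu) v (abs_le.1 hv) h
  have := Real.sigmoid_le h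
  rw [abs_of_nonpos (by linarith), abs_of_nonpos (by linarith)]
  linarith

/-- The log-likelihood ratio of one comparison, split into its noise and its drift. -/
lemma log_lik_sub_le {d : ℕ} {B : ℝ} (hB : 0 ≤ B) (f g : Pt d → ℝ) (x x' : Pt d) (b : Bool)
    (hf : |f x - f x'| ≤ 2 * B) (hg : |g x - g x'| ≤ 2 * B) :
    Real.log (lik g x x' b) - Real.log (lik f x x' b)
      ≤ ((if b then 1 else 0) - Real.sigmoid (f x - f x')) * ((g x - g x') - (f x - f x'))
        - dsigLow B ^ 2 / 2 * ((g x - g x') - (f x - f x')) ^ 2 := by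
  set u := f x - f x' with hu
  set v := g x - g x' with hv
  have h1 := bernoulli_drift_le (Real.sigmoid_pos u) (Real.sigmoid_lt_one u)
    (Real.sigmoid_pos v) (Real.sigmoid_lt_one v)
  have h2 := log_sigmoid_sub_log_one_sub u
  have h3 := log_sigmoid_sub_log_one_sub v
  have h4 : dsigLow B ^ 2 / 2 * (v - u) ^ 2 ≤ (Real.sigmoid u - Real.sigmoid v) ^ 2 / 2 := by
    have := pow_le_pow_left₀ (mul_nonneg (dsigLow_pos B).le (abs_nonneg _))
      (dsigLow_mul_abs_le hB hf hg) 2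
    rw [mul_pow, sq_abs, sq_abs] at this
    nlinarith
  -- Eliminating log σ in favour of log (1 - σ) makes the log-ratio affine in the outcome, with
  -- slope v - u.
  have h5 : Real.log (Real.sigmoid v) = v + Real.log (1 - Real.sigmoid v) := by linarith
  have h6 : Real.log (Real.sigmoid u) = u + Real.log (1 - Real.sigmoid u) := by linarith
  rw [h5, h6] at h1
  cases b
  · simp only [lik, Bool.false_eq_true, if_false, ← hu, ← hv]
    nlinarith
  · simp only [lik, if_true, ← hu, ← hv]
    rw [h5, h6]
    nlinarith

lemma logLik_sub_le {d : ℕ} {B : ℝ} (hB : 0 ≤ B) (f g : Pt d → ℝ) (x x' : ℕ → Pt d)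
    (o : ℕ → Bool) (t : ℕ)
    (hf : ∀ τ ∈ Finset.Icc 1 t, |f (x τ) - f (x' τ)| ≤ 2 * B)
    (hg : ∀ τ ∈ Finset.Icc 1 t, |g (x τ) - g (x' τ)| ≤ 2 * B) :
    logLik g x x' o t - logLik f x x' o t
      ≤ ∑ τ ∈ Finset.Icc 1 t, ((if o τ then 1 else 0) - Real.sigmoid (f (x τ) - f (x' τ)))
          * ((g (x τ) - g (x' τ)) - (f (x τ) - f (x' τ)))
        - dsigLow B ^ 2 / 2
          * ∑ τ ∈ Finset.Icc 1 t, ((g (x τ) - g (x' τ)) - (f (x τ) - f (x' τ))) ^ 2 := by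
  rw [logLik, logLik, ← Finset.sum_sub_distrib, Finset.mul_sum, ← Finset.sum_sub_distrib]
  exact Finset.sum_le_sum fun τ hτ => log_lik_sub_le hB f g _ _ _ (hf τ hτ) (hg τ hτ)

lemma abs_logLik_sub_le {d : ℕ} {ε : ℝ} (g h : Pt d → ℝ) (x x' : ℕ → Pt d)
    (o : ℕ → Bool) (t : ℕ)
    (hx : ∀ τ ∈ Finset.Icc 1 t, |g (x τ) - h (x τ)| ≤ ε)
    (hx' : ∀ τ ∈ Finset.Icc 1 t, |g (x' τ) - h (x' τ)| ≤ ε) :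
    |logLik g x x' o t - logLik h x x' o t| ≤ 2 * ε * t := by
  rw [logLik, logLik, ← Finset.sum_sub_distrib]
  refine (Finset.abs_sum_le_sum_abs _ _).trans ?_
  calc _ ≤ ∑ τ ∈ Finset.Icc 1 t, 2 * ε := by
        refine Finset.sum_le_sum fun τ hτ => (abs_log_lik_sub_le g h _ _ _).trans ?_
        have h1 := abs_le.1 (hx τ hτ)
        have h2 := abs_le.1 (hx' τ hτ)
        rw [abs_le]; constructor <;> linarith
    _ = _ := by simp; ring

section Noise


/-! ### A Chernoff bound for predictable transforms of Bernoulli noise -/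

/-- The graph of exp lies below its chord over [-r, r]; the weights of r and -r are (1 + y)/2 and (1
- y)/2. -/
lemma exp_le_cosh_add_mul_sinh {r y : ℝ} (hy : |y| ≤ 1) :
    Real.exp (r * y) ≤ Real.cosh r + y * Real.sinh r := by
  obtain ⟨h1, h2⟩ := abs_le.1 hy
  have h := convexOn_exp.2 (mem_univ r) (mem_univ (-r)) (by linarith : 0 ≤ (1 + y) / 2)
    (by linarith : 0 ≤ (1 - y) / 2) (by ring)
  simp only [smul_eq_mul] at h
  rw [Real.cosh_eq, Real.sinh_eq]
  have e : (1 + y) / 2 * r + (1 - y) / 2 * -r = r * y := by ring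
  rw [e] at h
  linarith

/-- The centred outcome has mean zero, so averaging the chord bounds removes the sinh terms and
leaves cosh(sD) ≤ exp(s²D²/2). Hoeffding's lemma would have 8 in place of 2; the constant 32 in β₁
leaves room for this loss. -/
lemma bernoulli_mgf_le {p D R s : ℝ} (hp0 : 0 ≤ p) (hp1 : p ≤ 1) (hD : |D| ≤ R) :
    p * Real.exp (s * ((1 - p) * D)) + (1 - p) * Real.exp (s * ((0 - p) * D))
      ≤ Real.exp (s ^ 2 * R ^ 2 / 2) := by
  have h1 := exp_le_cosh_add_mul_sinh (r := s * D) (y := 1 - p)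
    (abs_le.2 ⟨by linarith, by linarith⟩)
  have h2 := exp_le_cosh_add_mul_sinh (r := s * D) (y := 0 - p)
    (abs_le.2 ⟨by linarith, by linarith⟩)
  have h3 := Real.cosh_le_exp_half_sq (s * D)
  have h4 : Real.exp ((s * D) ^ 2 / 2) ≤ Real.exp (s ^ 2 * R ^ 2 / 2) := by
    apply Real.exp_le_exp.2
    have := pow_le_pow_left₀ (abs_nonneg D) hD 2
    rw [sq_abs] at this
    rw [mul_pow]
    have := mul_le_mul_of_nonneg_left this (sq_nonneg s)
    linarith
  have e1 : s * ((1 - p) * D) = s * D * (1 - p) := by ring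
  have e2 : s * ((0 - p) * D) = s * D * (0 - p) := by ring
  rw [e1, e2]
  have h5 := mul_le_mul_of_nonneg_left h1 hp0
  have h6 := mul_le_mul_of_nonneg_left h2 (by linarith : 0 ≤ 1 - p)
  nlinarith

lemma measurable_ite_bool {Ω : Type*} {m : MeasurableSpace Ω} {o : Ω → Bool} (ho : Measurable[m] o) :
    Measurable[m] (fun ω => if o ω then (1 : ℝ) else 0) :=
  (measurable_from_top (f := fun b : Bool => if b then (1 : ℝ) else 0)).comp ho

variable {Ω : Type*} [mΩ : MeasurableSpace Ω] {μ : Measure Ω}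

/-- Against a bounded weight known in the past, an outcome can be replaced by its conditional
probability. -/
lemma integral_mul_indicator_eq [IsProbabilityMeasure μ] {m : MeasurableSpace Ω} (hm : m ≤ mΩ)
    {W p : Ω → ℝ} {K : ℝ} (hW : Measurable[m] W) (hWb : ∀ ω, |W ω| ≤ K)
    {o : Ω → Bool} (ho : Measurable[mΩ] o)
    (hc : μ[{ω | o ω = true}.indicator (fun _ => (1 : ℝ)) | m] =ᵐ[μ] p) :
    ∫ ω, W ω * (if o ω then 1 else 0) ∂μ = ∫ ω, W ω * p ω ∂μ := by
  set I : Ω → ℝ := {ω | o ω = true}.indicator (fun _ => (1 : ℝ)) with hI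
  have hS : MeasurableSet[mΩ] {ω | o ω = true} := ho (MeasurableSet.singleton true)
  have hIi : Integrable I μ := (integrable_const (1 : ℝ)).indicator hS
  have hWI : Integrable (W * I) μ :=
    hIi.bdd_mul (hW.mono hm le_rfl).aestronglyMeasurable (Filter.Eventually.of_forall hWb)
  have h1 : μ[W * I | m] =ᵐ[μ] W * μ[I | m] :=
    condExp_mul_of_stronglyMeasurable_left hW.stronglyMeasurable hWI hIi
  have h2 : ∫ ω, (W * I) ω ∂μ = ∫ ω, (μ[W * I | m]) ω ∂μ := (integral_condExp hm).symm
  have h3 : ∫ ω, W ω * (if o ω then 1 else 0) ∂μ = ∫ ω, (W * I) ω ∂μ := by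
    refine integral_congr_ae (Filter.Eventually.of_forall fun ω => ?_)
    simp [hI, indicator_apply]
  rw [h3, h2]
  refine integral_congr_ae ?_
  filter_upwards [h1, hc] with ω h1 hc
  rw [h1, Pi.mul_apply, hc]

/-- The compensated outcomes, weighted by a predictable process `D` and summed up to time `t`. -/
noncomputable def noise (o : ℕ → Ω → Bool) (p D : ℕ → Ω → ℝ) (t : ℕ) (ω : Ω) : ℝ :=
  ∑ τ ∈ Finset.Icc 1 t, ((if o τ ω then 1 else 0) - p τ ω) * D τ ω

/-- `o` is a sequence of outcomes with predictable success probabilities `p`, and `D` a predictable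
process bounded by `R`, over the steps `1, …, T`. -/
structure IsPredictableBernoulli (μ : Measure Ω) (ℱ : Filtration ℕ mΩ) (T : ℕ) (R : ℝ)
    (o : ℕ → Ω → Bool) (p D : ℕ → Ω → ℝ) : Prop where
  meas_p : ∀ t ∈ Finset.Icc 1 T, Measurable[ℱ (t - 1)] (p t)
  meas_D : ∀ t ∈ Finset.Icc 1 T, Measurable[ℱ (t - 1)] (D t)
  meas_o : ∀ t ∈ Finset.Icc 1 T, Measurable[ℱ t] (o t)
  p_nonneg : ∀ t ω, 0 ≤ p t ω
  p_le_one : ∀ t ω, p t ω ≤ 1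
  abs_D_le : ∀ t ∈ Finset.Icc 1 T, ∀ ω, |D t ω| ≤ R
  condExp_eq : ∀ t ∈ Finset.Icc 1 T,
    μ[{ω | o t ω = true}.indicator (fun _ => (1 : ℝ)) | ℱ (t - 1)] =ᵐ[μ] p t

variable {ℱ : Filtration ℕ mΩ} {T : ℕ} {R : ℝ} {o : ℕ → Ω → Bool} {p D : ℕ → Ω → ℝ}

lemma IsPredictableBernoulli.measurable_noise (h : IsPredictableBernoulli μ ℱ T R o p D)
    {t : ℕ} (ht : t ≤ T) : Measurable[ℱ t] (noise o p D t) := by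
  unfold noise
  refine Finset.measurable_sum _ fun τ hτ => ?_
  rw [Finset.mem_Icc] at hτ
  have hτT : τ ∈ Finset.Icc 1 T := Finset.mem_Icc.2 ⟨hτ.1, hτ.2.trans ht⟩
  have ho := measurable_ite_bool ((h.meas_o τ hτT).mono (ℱ.mono hτ.2) le_rfl)
  have hle : ℱ (τ - 1) ≤ ℱ t := ℱ.mono (by omega)
  exact (ho.sub ((h.meas_p τ hτT).mono hle le_rfl)).mul ((h.meas_D τ hτT).mono hle le_rfl)

lemma IsPredictableBernoulli.abs_noise_le (h : IsPredictableBernoulli μ ℱ T R o p D)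
    {t : ℕ} (ht : t ≤ T) (ω : Ω) : |noise o p D t ω| ≤ t * R := by
  unfold noise
  refine (Finset.abs_sum_le_sum_abs _ _).trans ?_
  calc _ ≤ ∑ τ ∈ Finset.Icc 1 t, R := by
        refine Finset.sum_le_sum fun τ hτ => ?_
        rw [Finset.mem_Icc] at hτ
        have hD := h.abs_D_le τ (Finset.mem_Icc.2 ⟨hτ.1, hτ.2.trans ht⟩) ω
        have h0 := h.p_nonneg τ ω
        have h1 := h.p_le_one τ ω
        rw [abs_mul]
        have : |(if o τ ω then (1 : ℝ) else 0) - p τ ω| ≤ 1 := by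
          split_ifs <;> rw [abs_le] <;> constructor <;> linarith
        exact (mul_le_of_le_one_left (abs_nonneg _) this).trans hD
    _ = _ := by simp

lemma IsPredictableBernoulli.integrable_exp_noise [IsProbabilityMeasure μ]
    (h : IsPredictableBernoulli μ ℱ T R o p D)
    {t : ℕ} (ht : t ≤ T) (s : ℝ) : Integrable (fun ω => Real.exp (s * noise o p D t ω)) μ := by
  have hm : Measurable (noise o p D t) := (h.measurable_noise ht).mono (ℱ.le t) le_rfl
  refine Integrable.of_bound (C := Real.exp (|s| * (t * R)))
    (by fun_prop) (Filter.Eventually.of_forall fun ω => ?_)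
  rw [Real.norm_eq_abs, Real.abs_exp, Real.exp_le_exp]
  refine (le_abs_self _).trans ?_
  rw [abs_mul]
  exact mul_le_mul_of_nonneg_left (h.abs_noise_le ht ω) (abs_nonneg s)

/-- Induction, peeling off the last step. Its exponential factor is a on success and b on failure,
hence b + (a - b)·1_success. Everything but the indicator is known one step earlier, so under the
integral the indicator may be replaced by p, and `bernoulli_mgf_le` applies pointwise. -/
lemma IsPredictableBernoulli.mgf_noise_le [IsProbabilityMeasure μ]
    (h : IsPredictableBernoulli μ ℱ T R o p D) (s : ℝ) :
    ∀ t ≤ T, mgf (noise o p D t) μ s ≤ Real.exp (s ^ 2 * R ^ 2 / 2 * t) := by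
  intro t
  induction t with
  | zero => intro _; simp [mgf, noise]
  | succ t ih =>
    intro ht
    have htT : t ≤ T := by omega
    have hmem : t + 1 ∈ Finset.Icc 1 T := Finset.mem_Icc.2 ⟨by omega, ht⟩
    have hM := h.measurable_noise htT
    have hp := h.meas_p _ hmem
    have hD := h.meas_D _ hmem
    rw [Nat.add_sub_cancel] at hp hD
    have hc := h.condExp_eq _ hmem
    rw [Nat.add_sub_cancel] at hc
    have ho : Measurable (o (t + 1)) := (h.meas_o _ hmem).mono (ℱ.le _) le_rfl
    set M : Ω → ℝ := fun ω => Real.exp (s * noise o p D t ω) with hMdef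
    set a : Ω → ℝ := fun ω => Real.exp (s * ((1 - p (t + 1) ω) * D (t + 1) ω)) with ha
    set b : Ω → ℝ := fun ω => Real.exp (s * ((0 - p (t + 1) ω) * D (t + 1) ω)) with hb
    have hMm : Measurable[ℱ t] M := Real.measurable_exp.comp (hM.const_mul s)
    have ham : Measurable[ℱ t] a :=
      Real.measurable_exp.comp (((hp.const_sub 1).mul hD).const_mul s)
    have hbm : Measurable[ℱ t] b :=
      Real.measurable_exp.comp (((hp.const_sub 0).mul hD).const_mul s)
    have expb : ∀ {y K : ℝ}, |y| ≤ K → |Real.exp (s * y)| ≤ Real.exp (|s| * K) := by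
      intro y K hy
      rw [Real.abs_exp, Real.exp_le_exp]
      refine (le_abs_self _).trans ?_
      rw [abs_mul]
      exact mul_le_mul_of_nonneg_left hy (abs_nonneg s)
    have hMb : ∀ ω, |M ω| ≤ Real.exp (|s| * (t * R)) := fun ω => expb (h.abs_noise_le htT ω)
    have hDb := h.abs_D_le _ hmem
    have hab : ∀ ω, |a ω| ≤ Real.exp (|s| * R) := fun ω => expb <| by
      rw [abs_mul]
      have h0 := h.p_nonneg (t + 1) ω
      have h1 := h.p_le_one (t + 1) ω
      exact (mul_le_of_le_one_left (abs_nonneg _)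
        (abs_le.2 ⟨by linarith, by linarith⟩)).trans (hDb ω)
    have hbb : ∀ ω, |b ω| ≤ Real.exp (|s| * R) := fun ω => expb <| by
      rw [abs_mul]
      have h0 := h.p_nonneg (t + 1) ω
      have h1 := h.p_le_one (t + 1) ω
      exact (mul_le_of_le_one_left (abs_nonneg _)
        (abs_le.2 ⟨by linarith, by linarith⟩)).trans (hDb ω)
    set W : Ω → ℝ := fun ω => M ω * (a ω - b ω) with hWdef
    have hWm : Measurable[ℱ t] W := hMm.mul (ham.sub hbm)
    have hWb : ∀ ω, |W ω| ≤ Real.exp (|s| * (t * R)) * (2 * Real.exp (|s| * R)) := fun ω => by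
      rw [hWdef, abs_mul]
      refine mul_le_mul (hMb ω) ?_ (abs_nonneg _) (Real.exp_pos _).le
      exact (abs_sub _ _).trans (by linarith [hab ω, hbb ω])
    have hMi : Integrable M μ := h.integrable_exp_noise htT s
    have key := integral_mul_indicator_eq (ℱ.le t) hWm hWb ho hc
    have bdd : ∀ {X : Ω → ℝ} {K : ℝ}, Measurable X → (∀ ω, |X ω| ≤ K) → Integrable X μ :=
      fun hX hK => Integrable.of_bound hX.aestronglyMeasurable _ (Filter.Eventually.of_forall hK)
    have lt : ∀ {X : Ω → ℝ}, Measurable[ℱ t] X → Measurable X := fun hX => hX.mono (ℱ.le t) le_rfl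
    have hMbi : Integrable (fun ω => M ω * b ω) μ := by
      refine bdd ((lt hMm).mul (lt hbm)) (K := Real.exp (|s| * (t * R)) * Real.exp (|s| * R))
        fun ω => ?_
      rw [abs_mul]
      exact mul_le_mul (hMb ω) (hbb ω) (abs_nonneg _) (Real.exp_pos _).le
    have hWi : Integrable W μ := bdd (lt hWm) hWb
    have hWoi : Integrable (fun ω => W ω * (if o (t + 1) ω then 1 else 0)) μ := by
      refine bdd ((lt hWm).mul (measurable_ite_bool ho)) (K := Real.exp (|s| * (t * R)) *
        (2 * Real.exp (|s| * R))) fun ω => ?_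
      rw [abs_mul]
      refine (mul_le_of_le_one_right (abs_nonneg _) ?_).trans (hWb ω)
      split_ifs <;> simp
    have hWpi : Integrable (fun ω => W ω * p (t + 1) ω) μ := by
      refine bdd ((lt hWm).mul (lt hp)) (K := Real.exp (|s| * (t * R)) *
        (2 * Real.exp (|s| * R))) fun ω => ?_
      rw [abs_mul]
      refine (mul_le_of_le_one_right (abs_nonneg _) ?_).trans (hWb ω)
      rw [abs_of_nonneg (h.p_nonneg _ _)]
      exact h.p_le_one _ _
    have step : ∀ ω, Real.exp (s * noise o p D (t + 1) ω)
        = M ω * b ω + W ω * (if o (t + 1) ω then 1 else 0) := by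
      intro ω
      have e : noise o p D (t + 1) ω = noise o p D t ω
          + ((if o (t + 1) ω then 1 else 0) - p (t + 1) ω) * D (t + 1) ω := by
        unfold noise
        rw [Finset.sum_Icc_succ_top (by omega)]
      rw [e, mul_add, Real.exp_add]
      simp only [hWdef, ha, hb, hMdef]
      split_ifs <;> ring
    calc mgf (noise o p D (t + 1)) μ s
        = ∫ ω, (M ω * b ω + W ω * (if o (t + 1) ω then 1 else 0)) ∂μ := by
          unfold mgf
          exact integral_congr_ae (Filter.Eventually.of_forall step)
      _ = ∫ ω, (M ω * b ω + W ω * p (t + 1) ω) ∂μ := by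
          rw [integral_add hMbi hWoi, key, integral_add hMbi hWpi]
      _ ≤ ∫ ω, M ω * Real.exp (s ^ 2 * R ^ 2 / 2) ∂μ := by
          refine integral_mono (hMbi.add hWpi) (hMi.mul_const _) fun ω => ?_
          have hk := bernoulli_mgf_le (s := s) (h.p_nonneg (t + 1) ω) (h.p_le_one (t + 1) ω) (hDb ω)
          have hM0 : 0 ≤ M ω := (Real.exp_pos _).le
          calc M ω * b ω + W ω * p (t + 1) ω
              = M ω * (p (t + 1) ω * a ω + (1 - p (t + 1) ω) * b ω) := by
                simp only [hWdef]; ring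
            _ ≤ _ := mul_le_mul_of_nonneg_left hk hM0
      _ = mgf (noise o p D t) μ s * Real.exp (s ^ 2 * R ^ 2 / 2) := integral_mul_const _ _
      _ ≤ Real.exp (s ^ 2 * R ^ 2 / 2 * t) * Real.exp (s ^ 2 * R ^ 2 / 2) :=
          mul_le_mul_of_nonneg_right (ih htT) (Real.exp_pos _).le
      _ = _ := by rw [← Real.exp_add]; push_cast; ring_nf

lemma IsPredictableBernoulli.measure_noise_ge_le [IsProbabilityMeasure μ]
    (h : IsPredictableBernoulli μ ℱ T R o p D) (hR : 0 < R) {t : ℕ} (ht1 : 1 ≤ t) (htT : t ≤ T)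
    {l : ℝ} (hl : 0 ≤ l) :
    μ.real {ω | √(2 * t * R ^ 2 * l) ≤ noise o p D t ω} ≤ Real.exp (-l) := by
  set r := √(2 * t * R ^ 2 * l) with hr
  have ht : (0 : ℝ) < t := by exact_mod_cast ht1
  have hr2 : r ^ 2 = 2 * t * R ^ 2 * l := Real.sq_sqrt (by positivity)
  -- The minimizer of -s r + s² R² t / 2; the two terms become -2l and l.
  set s := r / (t * R ^ 2) with hs
  have hs0 : 0 ≤ s := div_nonneg (Real.sqrt_nonneg _) (by positivity)
  have h1 := measure_ge_le_exp_mul_mgf (X := noise o p D t) (μ := μ) r hs0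
    (h.integrable_exp_noise htT s)
  refine h1.trans ?_
  calc Real.exp (-s * r) * mgf (noise o p D t) μ s
      ≤ Real.exp (-s * r) * Real.exp (s ^ 2 * R ^ 2 / 2 * t) :=
        mul_le_mul_of_nonneg_left (h.mgf_noise_le s t htT) (Real.exp_pos _).le
    _ = Real.exp (-l) := by
        rw [← Real.exp_add]
        congr 1
        have e1 : s * r = 2 * l := by
          rw [hs, div_mul_eq_mul_div, ← sq, hr2]; field_simp
        have e2 : s ^ 2 * R ^ 2 / 2 * t = l := by
          rw [hs, div_pow, hr2]; field_simp
        rw [e2]; linarith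

end Noise

/-! ### The elliptical potential bound in a Hilbert space -/

section Elliptic

variable {E : Type*} [NormedAddCommGroup E] [InnerProductSpace ℝ E]

open scoped RealInnerProductSpace

/-- The regularized Gram matrix `I + λ⁻¹ (⟪φ i, φ j⟫)` of the first `n` vectors of a sequence. -/
noncomputable def regGram (φ : ℕ → E) (lam : ℝ) (n : ℕ) : Matrix (Fin n) (Fin n) ℝ :=
  1 + lam⁻¹ • Matrix.of fun i j : Fin n => ⟪φ i, φ j⟫

lemma regGram_posDef (φ : ℕ → E) {lam : ℝ} (hlam : 0 < lam) (n : ℕ) :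
    (regGram φ lam n).PosDef :=
  Matrix.PosDef.one.add_posSemidef
    ((Matrix.posSemidef_gram ℝ (fun i : Fin n => φ i)).smul (inv_pos.2 hlam).le)

/-- Cauchy–Schwarz in two dimensions, written with squares. In `exists_regGram_succ` it joins the
residual part and the coefficient part of a prediction. -/
lemma add_sq_le_mul_add {x y A P C Q : ℝ} (hA : 0 ≤ A) (hP : 0 ≤ P) (hC : 0 ≤ C) (hQ : 0 ≤ Q)
    (hx : x ^ 2 ≤ A * C) (hy : y ^ 2 ≤ P * Q) : (x + y) ^ 2 ≤ (A + P) * (C + Q) := by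
  have h1 : (x * y) ^ 2 ≤ (A * Q) * (P * C) := by
    have := mul_le_mul hx hy (sq_nonneg y) (by positivity)
    nlinarith
  have h2 : 2 * (x * y) ≤ A * Q + P * C := by
    refine abs_le_of_sq_le_sq' ?_ (by positivity) |>.2
    nlinarith [sq_nonneg (A * Q - P * C)]
  nlinarith

/-- Adding one vector multiplies the determinant of the regularized Gram matrix by
`1 + s / λ`, where `s` is the regularized squared distance of the new vector from the span of the
previous ones. -/
lemma exists_regGram_succ (φ : ℕ → E) {lam : ℝ} (hlam : 0 < lam) (n : ℕ) :
    ∃ s : ℝ, 0 ≤ s ∧ s ≤ ‖φ n‖ ^ 2 ∧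
      (regGram φ lam (n + 1)).det = (regGram φ lam n).det * (1 + s / lam) ∧
      ∀ F : E, ⟪F, φ n⟫ ^ 2
        ≤ (‖F‖ ^ 2 + lam⁻¹ * ∑ i ∈ Finset.range n, ⟪F, φ i⟫ ^ 2) * s := by
  classical
  set A := regGram φ lam n with hA
  have hdet : 0 < A.det := (regGram_posDef φ hlam n).det_pos
  set v : Fin n → ℝ := fun i => ⟪φ i, φ n⟫ with hv
  -- Coefficients of the ridge regression of φ n on the earlier vectors: `hai` is the normal
  -- equation, w the fitted value and r the residual.
  set a : Fin n → ℝ := A⁻¹.mulVec (lam⁻¹ • v) with ha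
  have hAa : A.mulVec a = lam⁻¹ • v := by
    rw [ha, Matrix.mulVec_mulVec, Matrix.mul_nonsing_inv _ (isUnit_iff_ne_zero.2 hdet.ne'),
      Matrix.one_mulVec]
  have hai : ∀ i, lam * a i + ∑ j : Fin n, ⟪φ i, φ j⟫ * a j = v i := by
    intro i
    have h := congrFun hAa i
    rw [hA, regGram, Matrix.add_mulVec, Matrix.one_mulVec, Matrix.smul_mulVec] at h
    simp only [Pi.add_apply, Pi.smul_apply, smul_eq_mul, Matrix.mulVec, dotProduct,
      Matrix.of_apply] at h
    have h' := congrArg (fun z => lam * z) h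
    simp only [mul_add] at h'
    rwa [mul_inv_cancel_left₀ hlam.ne', mul_inv_cancel_left₀ hlam.ne'] at h'
  set w : E := ∑ j : Fin n, a j • φ j with hw
  set r : E := φ n - w with hr
  have hir : ∀ i : Fin n, ⟪φ i, r⟫ = lam * a i := by
    intro i
    rw [hr, inner_sub_right, hw, inner_sum]
    simp only [real_inner_smul_right]
    have := hai i
    simp only [hv] at this
    rw [← this]
    simp only [mul_comm]
    ring
  have hwr : ⟪w, r⟫ = lam * ∑ i, a i ^ 2 := by
    rw [hw, sum_inner, Finset.mul_sum]
    refine Finset.sum_congr rfl fun i _ => ?_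
    rw [real_inner_smul_left, hir]; ring
  have hwn : ⟪w, φ n⟫ = ∑ i, a i * v i := by
    rw [hw, sum_inner]
    exact Finset.sum_congr rfl fun i _ => real_inner_smul_left _ _ _
  have hφ : φ n = r + w := by rw [hr]; abel
  have hwn' : ⟪w, φ n⟫ = lam * ∑ i, a i ^ 2 + ‖w‖ ^ 2 := by
    rw [hφ, inner_add_right, hwr, real_inner_self_eq_norm_sq]
  have hnorm : ‖φ n‖ ^ 2 = ‖r‖ ^ 2 + 2 * ⟪w, r⟫ + ‖w‖ ^ 2 := by
    rw [hφ, norm_add_sq_real, real_inner_comm]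
  -- Two forms of s: the left one gives the Schur complement 1 + s/λ in the determinant, the right
  -- one is the minimal ridge objective and serves the bound on predictions.
  have hs : ‖φ n‖ ^ 2 - ∑ i, a i * v i = ‖r‖ ^ 2 + lam * ∑ i, a i ^ 2 := by
    rw [← hwn, hwn', hnorm, hwr]; ring
  have hsum0 : 0 ≤ lam * ∑ i, a i ^ 2 :=
    mul_nonneg hlam.le (Finset.sum_nonneg fun i _ => sq_nonneg _)
  refine ⟨‖φ n‖ ^ 2 - ∑ i, a i * v i, ?_, ?_, ?_, ?_⟩
  · rw [hs]; positivity
  · rw [← hwn, hwn']; nlinarith [sq_nonneg ‖w‖]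
  · let _ : Invertible A := A.invertibleOfIsUnitDet (isUnit_iff_ne_zero.2 hdet.ne')
    have hblock : (regGram φ lam (n + 1)).submatrix (finSumFinEquiv (m := n) (n := 1))
        (finSumFinEquiv (m := n) (n := 1))
        = Matrix.fromBlocks A (Matrix.of fun i _ => lam⁻¹ * v i)
          (Matrix.of fun _ j => lam⁻¹ * v j)
          (Matrix.of fun _ _ => 1 + lam⁻¹ * ‖φ n‖ ^ 2) := by
      ext i j
      rcases i with i | i <;> rcases j with j | j
      · simp [regGram, hA, Matrix.one_apply]
      · have : (Fin.castAdd 1 i) ≠ Fin.natAdd n j := by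
          intro h; have := congrArg Fin.val h; simp at this; omega
        simp [regGram, hv, this]
      · have : (Fin.natAdd n i) ≠ Fin.castAdd 1 j := by
          intro h; have := congrArg Fin.val h; simp at this; omega
        simp [regGram, hv, this, real_inner_comm]
      · have hij : i = j := Subsingleton.elim _ _
        subst hij
        simp [regGram]
    rw [← Matrix.det_submatrix_equiv_self (finSumFinEquiv (m := n) (n := 1)), hblock,
      Matrix.det_fromBlocks₁₁, Matrix.invOf_eq_nonsing_inv, Matrix.det_fin_one]
    congr 1
    have e : ((Matrix.of fun (_ : Fin 1) j => lam⁻¹ * v j) * A⁻¹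
        * (Matrix.of fun i (_ : Fin 1) => lam⁻¹ * v i)) 0 0 = lam⁻¹ * ∑ i, a i * v i := by
      rw [Matrix.mul_assoc, Matrix.mul_apply, Finset.mul_sum]
      refine Finset.sum_congr rfl fun i _ => ?_
      have : (A⁻¹ * Matrix.of fun i (_ : Fin 1) => lam⁻¹ * v i) i 0 = a i := by
        rw [ha, Matrix.mul_apply]; rfl
      rw [this, Matrix.of_apply]; ring
    rw [Matrix.sub_apply, e, Matrix.of_apply, div_eq_inv_mul]
    ring
  · intro F
    rw [hs, ← Fin.sum_univ_eq_sum_range (fun i => ⟪F, φ i⟫ ^ 2)]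
    have e : ⟪F, φ n⟫ = ⟪F, r⟫ + ∑ i, a i * ⟪F, φ i⟫ := by
      rw [hφ, inner_add_right, hw, inner_sum]
      simp only [real_inner_smul_right]
    rw [e]
    -- Cauchy–Schwarz for ⟪F, r⟫ and for the coefficient sum; in the latter the weights λ and λ⁻¹
    -- cancel.
    refine add_sq_le_mul_add (sq_nonneg _) (mul_nonneg (inv_pos.2 hlam).le
      (Finset.sum_nonneg fun i _ => sq_nonneg _)) (sq_nonneg _) hsum0 ?_ ?_
    · rw [← mul_pow]
      exact sq_le_sq' (by linarith [neg_le_of_abs_le (abs_real_inner_le_norm F r)])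
        (real_inner_le_norm F r)
    · refine (Finset.sum_mul_sq_le_sq_mul_sq _ _ _).trans (le_of_eq ?_)
      field_simp

/-- Elliptical potential bound for a sum of predictions `⟪F n, φ n⟫`. -/
theorem sq_sum_inner_le_log_det (φ F : ℕ → E) {lam b M : ℝ} (hlam : 0 < lam) (T : ℕ)
    (hM : 0 ≤ M) (hb : ∀ n < T, ‖φ n‖ ^ 2 ≤ b)
    (hF : ∀ n < T, ‖F n‖ ^ 2 + lam⁻¹ * ∑ i ∈ Finset.range n, ⟪F n, φ i⟫ ^ 2 ≤ M) :
    (∑ n ∈ Finset.range T, ⟪F n, φ n⟫) ^ 2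
      ≤ T * (M * ((lam + b) * Real.log (regGram φ lam T).det)) := by
  choose s hs0 hsn hdet hsF using exists_regGram_succ φ hlam
  have hpos : ∀ n, 0 < 1 + s n / lam := fun n => by have := hs0 n; positivity
  have hlog : ∀ n, Real.log (regGram φ lam n).det
      = ∑ i ∈ Finset.range n, Real.log (1 + s i / lam) := by
    intro n
    induction n with
    | zero => simp
    | succ n ih =>
      rw [hdet, Real.log_mul (regGram_posDef φ hlam n).det_pos.ne' (hpos n).ne', ih,
        Finset.sum_range_succ]
  -- From log (1 + x) ≥ x / (1 + x) at x = s/λ, together with s ≤ b in the denominator λ + s.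
  have hsl : ∀ n < T, s n ≤ (lam + b) * Real.log (1 + s n / lam) := by
    intro n hn
    have h1 := Real.one_sub_inv_le_log_of_pos (hpos n)
    have h2 : 1 - (1 + s n / lam)⁻¹ = s n / (lam + s n) := by
      have : lam + s n ≠ 0 := by have := hs0 n; positivity
      field_simp
      ring
    rw [h2] at h1
    have h3 : s n ≤ b := (hsn n).trans (hb n hn)
    have h0 := hs0 n
    calc s n = (lam + s n) * (s n / (lam + s n)) := by
          have : lam + s n ≠ 0 := by positivity
          field_simp
      _ ≤ (lam + b) * (s n / (lam + s n)) :=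
          mul_le_mul_of_nonneg_right (by linarith) (by positivity)
      _ ≤ _ := mul_le_mul_of_nonneg_left h1 (by linarith)
  calc (∑ n ∈ Finset.range T, ⟪F n, φ n⟫) ^ 2
      ≤ T * ∑ n ∈ Finset.range T, ⟪F n, φ n⟫ ^ 2 := by
        simpa using sq_sum_le_card_mul_sum_sq (s := Finset.range T) (f := fun n => ⟪F n, φ n⟫)
    _ ≤ T * ∑ n ∈ Finset.range T, M * ((lam + b) * Real.log (1 + s n / lam)) := by
        refine mul_le_mul_of_nonneg_left (Finset.sum_le_sum fun n hn => ?_) (Nat.cast_nonneg T)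
        have hn := Finset.mem_range.1 hn
        calc _ ≤ _ := hsF n (F n)
          _ ≤ M * s n := mul_le_mul_of_nonneg_right (hF n hn) (hs0 n)
          _ ≤ _ := mul_le_mul_of_nonneg_left (hsl n hn) hM
    _ = _ := by rw [hlog, ← Finset.mul_sum, ← Finset.mul_sum]

end Elliptic

/-! ### The reproducing kernel Hilbert space -/

section Kernel

open scoped RealInnerProductSpace

variable {d : ℕ} {H : Type*} [NormedAddCommGroup H] [InnerProductSpace ℝ H] [CompleteSpace H]
  [RKHS ℝ H (Pt d) ℝ] {k : Pt d → Pt d → ℝ} {X : Set (Pt d)} {B : ℝ}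

variable (H) in
/-- The kernel section at `z`, which represents evaluation at `z`. -/
noncomputable def kerAt (z : Pt d) : H := RKHS.kerFun H z (1 : ℝ)

lemma inner_kerAt (z : Pt d) (g : H) : ⟪kerAt H z, g⟫ = g z := by
  rw [kerAt, RKHS.kerFun_inner]; simp

lemma inner_kerAt_kerAt (hH : IsRKHSOf H k) (x y : Pt d) : ⟪kerAt H x, kerAt H y⟫ = k x y := by
  rw [inner_kerAt, kerAt, RKHS.kerFun_apply, hH]

lemma norm_kerAt_sq (hH : IsRKHSOf H k) (x : Pt d) : ‖kerAt H x‖ ^ 2 = k x x := by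
  rw [← real_inner_self_eq_norm_sq, inner_kerAt_kerAt hH]

lemma norm_kerAt_le_one (hH : IsRKHSOf H k) (hk1 : ∀ x ∈ X, ∀ y ∈ X, k x y ≤ 1) {x : Pt d}
    (hx : x ∈ X) : ‖kerAt H x‖ ≤ 1 := by
  rw [← sq_le_one_iff₀ (norm_nonneg _), norm_kerAt_sq hH]
  exact hk1 x hx x hx

lemma abs_apply_le_norm (hH : IsRKHSOf H k) (hk1 : ∀ x ∈ X, ∀ y ∈ X, k x y ≤ 1) {x : Pt d}
    (hx : x ∈ X) (g : H) : |g x| ≤ ‖g‖ := by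
  rw [← inner_kerAt]
  exact (abs_real_inner_le_norm _ _).trans
    (mul_le_of_le_one_left (norm_nonneg _) (norm_kerAt_le_one hH hk1 hx))

lemma abs_apply_sub_le (hH : IsRKHSOf H k) (hk1 : ∀ x ∈ X, ∀ y ∈ X, k x y ≤ 1) {x y : Pt d}
    (hx : x ∈ X) (hy : y ∈ X) {g : H} (hg : ‖g‖ ≤ B) : |g x - g y| ≤ 2 * B := by
  have h1 := (abs_apply_le_norm hH hk1 hx g).trans hg
  have h2 := (abs_apply_le_norm hH hk1 hy g).trans hg
  exact (abs_sub _ _).trans (by linarith)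

lemma continuous_kerAt (hH : IsRKHSOf H k)
    (hkc : Continuous fun p : Pt d × Pt d => k p.1 p.2) : Continuous (kerAt H (d := d)) := by
  rw [continuous_iff_continuousAt]
  intro y
  rw [ContinuousAt, tendsto_iff_norm_sub_tendsto_zero]
  have e : ∀ x, ‖kerAt H x - kerAt H y‖ = √(k x x - 2 * k x y + k y y) := by
    intro x
    rw [← norm_kerAt_sq hH x, ← norm_kerAt_sq hH y, ← inner_kerAt_kerAt hH x y,
      ← norm_sub_sq_real, Real.sqrt_sq (norm_nonneg _)]
  simp only [e]
  have h1 : Continuous fun x => k x x := hkc.comp (continuous_id.prodMk continuous_id)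
  have h2 : Continuous fun x => k x y := hkc.comp (continuous_id.prodMk continuous_const)
  have h3 : Continuous fun x => √(k x x - 2 * k x y + k y y) := by fun_prop
  have h4 := h3.tendsto y
  have e2 : k y y - 2 * k y y + k y y = 0 := by ring
  rwa [e2, Real.sqrt_zero] at h4

lemma continuous_apply (hH : IsRKHSOf H k)
    (hkc : Continuous fun p : Pt d × Pt d => k p.1 p.2) (g : H) : Continuous fun z => g z := by
  have : (fun z => g z) = fun z => ⟪kerAt H z, g⟫ := funext fun z => (inner_kerAt z g).symm
  rw [this]
  exact (continuous_kerAt hH hkc).inner continuous_const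

/-! ### Covering numbers -/

/-- By the reproducing property, ‖k_x - k_y‖ B is a modulus of continuity common to the whole ball.
-/
lemma equicontinuous_fball (hH : IsRKHSOf H k)
    (hkc : Continuous fun p : Pt d × Pt d => k p.1 p.2) :
    Equicontinuous fun (g : fball H B) (x : X) => (g : H) (x : Pt d) := by
  intro x
  refine Metric.equicontinuousAt_of_continuity_modulus
    (fun y : X => ‖kerAt H (x : Pt d) - kerAt H (y : Pt d)‖ * B) ?_ _ ?_
  · have h : Continuous fun y : X => ‖kerAt H (x : Pt d) - kerAt H (y : Pt d)‖ * B :=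
      ((continuous_const.sub ((continuous_kerAt hH hkc).comp continuous_subtype_val)).norm).mul
        continuous_const
    have := h.tendsto x
    simpa using this
  · refine Filter.Eventually.of_forall fun y g => ?_
    rw [Real.dist_eq, ← inner_kerAt, ← inner_kerAt, ← inner_sub_left]
    exact (abs_real_inner_le_norm _ _).trans
      (mul_le_mul_of_nonneg_left g.2 (norm_nonneg _))

/-- Arzelà–Ascoli: for an equicontinuous family on a compact space, uniform and pointwise
convergence induce the same uniformity. Pointwise the ball sits in a product of intervals [-B, B],
compact by Tychonoff. Closedness of the ball is not needed for total boundedness. -/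
lemma totallyBounded_fball (hXc : IsCompact X) (hH : IsRKHSOf H k)
    (hk1 : ∀ x ∈ X, ∀ y ∈ X, k x y ≤ 1)
    (hkc : Continuous fun p : Pt d × Pt d => k p.1 p.2) :
    TotallyBounded ((fun g : H =>
      (UniformFun.ofFun (fun x : X => g (x : Pt d)) : UniformFun X ℝ)) '' fball H B) := by
  have : CompactSpace X := isCompact_iff_compactSpace.1 hXc
  set F : fball H B → X → ℝ := fun g x => (g : H) (x : Pt d) with hF
  let _ : UniformSpace (fball H B) := UniformSpace.comap F inferInstance
  have hFu : IsUniformInducing F := ⟨rfl⟩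
  have hFe : Equicontinuous F := equicontinuous_fball hH hkc
  have hG : IsUniformInducing (UniformFun.ofFun ∘ F) :=
    hFe.isUniformInducing_uniformFun_iff_pi.2 hFu
  have hK : TotallyBounded (Set.pi univ fun _ : X => Icc (-B) B) :=
    (isCompact_univ_pi fun _ => isCompact_Icc).totallyBounded
  have h1 : TotallyBounded (univ : Set (fball H B)) := by
    refine TotallyBounded.subset (s₂ := F ⁻¹' Set.pi univ fun _ : X => Icc (-B) B) ?_
      (totallyBounded_preimage hFu hK)
    intro g _ x _
    exact abs_le.1 ((abs_apply_le_norm hH hk1 x.2 _).trans g.2)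
  have h2 := h1.image hG.uniformContinuous
  refine h2.subset ?_
  rintro _ ⟨g, hg, rfl⟩
  exact ⟨⟨g, hg⟩, mem_univ _, rfl⟩

lemma covNum_ne_top (hXc : IsCompact X) (hH : IsRKHSOf H k)
    (hk1 : ∀ x ∈ X, ∀ y ∈ X, k x y ≤ 1)
    (hkc : Continuous fun p : Pt d × Pt d => k p.1 p.2) {ε : ℝ} (hε : 0 < ε) :
    covNum H X B ε ≠ ⊤ := by
  obtain ⟨N, hN, hNf, hNc⟩ := Metric.exists_finite_isCover_of_totallyBounded
    (Real.toNNReal_pos.2 hε).ne' (totallyBounded_fball (B := B) hXc hH hk1 hkc)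
  exact ((hNc.coveringNumber_le_encard hN).trans_lt (encard_lt_top_iff.2 hNf)).ne

omit [CompleteSpace H] in
lemma one_le_covNum_toNat (hB : 0 ≤ B) {ε : ℝ} (h : covNum H X B ε ≠ ⊤) :
    1 ≤ (covNum H X B ε).toNat := by
  have h0 : (0 : H) ∈ fball H B := by simpa [fball] using hB
  rw [Nat.one_le_iff_ne_zero, Ne, ENat.toNat_eq_zero, not_or]
  exact ⟨(Metric.coveringNumber_pos_iff.2 (Set.Nonempty.image _ ⟨0, h0⟩)).ne', h⟩

omit [CompleteSpace H] in
/-- A minimal cover of the ball, indexed by numbers below the covering number. -/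
lemma exists_cover_fball {ε : ℝ} (hε : 0 ≤ ε) (h : covNum H X B ε ≠ ⊤) :
    ∃ c : Fin (covNum H X B ε).toNat → H, (∀ i, ‖c i‖ ≤ B) ∧
      ∀ g : H, ‖g‖ ≤ B → ∃ i, ∀ x ∈ X, |g x - c i x| ≤ ε := by
  obtain ⟨N, hN, hNf, hNc, hNe⟩ := Metric.exists_set_encard_eq_coveringNumber h
  have hcard : Nat.card N = (covNum H X B ε).toNat := by
    rw [Nat.card_coe_set_eq, Set.ncard_def, hNe]; rfl
  have : Finite N := hNf
  let e : Fin (covNum H X B ε).toNat ≃ N := (Finite.equivFinOfCardEq hcard).symm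
  have hN' : ∀ y : N, ∃ h : H, ‖h‖ ≤ B ∧
      (UniformFun.ofFun (fun x : X => h (x : Pt d)) : UniformFun X ℝ) = y := fun y => hN y.2
  choose c hc hc' using hN'
  refine ⟨fun i => c (e i), fun i => hc (e i), fun g hg => ?_⟩
  obtain ⟨y, hy, hgy⟩ := hNc (mem_image_of_mem _ (show g ∈ fball H B from hg))
  refine ⟨e.symm ⟨y, hy⟩, fun x hx => ?_⟩
  have hgy' := UniformFun.edist_le.1 (show edist _ _ ≤ _ from hgy) ⟨x, hx⟩
  have hcy : _ = y := hc' ⟨y, hy⟩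
  rw [← hcy] at hgy'
  have h2 : edist (g x) (c ⟨y, hy⟩ x) ≤ ENNReal.ofReal ε := hgy'
  rw [edist_dist, ENNReal.ofReal_le_ofReal_iff hε, Real.dist_eq] at h2
  simpa using h2

/-! ### The information gain -/

variable (H) in
/-- The feature map of the additive kernel on pairs. -/
noncomputable def pairFeature (w : Pt d × Pt d) : WithLp 2 (H × H) :=
  WithLp.toLp 2 (kerAt H w.1, kerAt H w.2)

lemma inner_pairFeature (hH : IsRKHSOf H k) (w v : Pt d × Pt d) :
    ⟪pairFeature H w, pairFeature H v⟫ = pairKernel k w v := by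
  rw [pairFeature, pairFeature, WithLp.prod_inner_apply]
  simp only [inner_kerAt_kerAt hH, pairKernel]

lemma norm_pairFeature_sq_le (hH : IsRKHSOf H k) (hk1 : ∀ x ∈ X, ∀ y ∈ X, k x y ≤ 1)
    {w : Pt d × Pt d} (hw : w ∈ X ×ˢ X) : ‖pairFeature H w‖ ^ 2 ≤ 2 := by
  rw [← real_inner_self_eq_norm_sq, inner_pairFeature hH, pairKernel]
  linarith [hk1 _ hw.1 _ hw.1, hk1 _ hw.2 _ hw.2]

lemma infoGain_eq_log_det_regGram (hH : IsRKHSOf H k) (lam : ℝ) (T : ℕ) (w : ℕ → Pt d × Pt d) :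
    infoGain k lam (fun i : Fin T => w i)
      = 1 / 2 * Real.log (regGram (fun n => pairFeature H (w n)) lam T).det := by
  simp only [infoGain, regGram, inner_pairFeature hH]

lemma det_infoGain_pos (hH : IsRKHSOf H k) {lam : ℝ} (hlam : 0 < lam) {T : ℕ}
    (w : Fin T → Pt d × Pt d) :
    0 < (1 + lam⁻¹ • (Matrix.of fun i j => pairKernel k (w i) (w j)) :
      Matrix (Fin T) (Fin T) ℝ).det := by
  -- `regGram` takes an infinite sequence; entries from T on do not enter, so 0 serves as filler.
  have h := (regGram_posDef (fun n => if h : n < T then pairFeature H (w ⟨n, h⟩) else 0)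
    hlam T).det_pos
  simpa [regGram, inner_pairFeature hH] using h

lemma continuous_infoGain (hH : IsRKHSOf H k)
    (hkc : Continuous fun p : Pt d × Pt d => k p.1 p.2) {lam : ℝ} (hlam : 0 < lam) (T : ℕ) :
    Continuous fun w : Fin T → Pt d × Pt d => infoGain k lam w := by
  unfold infoGain
  refine continuous_const.mul (Continuous.log ?_ fun w => (det_infoGain_pos hH hlam w).ne')
  refine Continuous.matrix_det (continuous_matrix fun i j => ?_)
  simp only [Matrix.add_apply, Matrix.smul_apply, Matrix.of_apply, pairKernel]
  have h1 : Continuous fun w : Fin T → Pt d × Pt d => ((w i).1, (w j).1) := by fun_prop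
  have h2 : Continuous fun w : Fin T → Pt d × Pt d => ((w i).2, (w j).2) := by fun_prop
  exact continuous_const.add (continuous_const.mul ((hkc.comp h1).add (hkc.comp h2)))

lemma isGreatest_maxInfoGain (hXc : IsCompact X) (hXne : X.Nonempty) (hH : IsRKHSOf H k)
    (hkc : Continuous fun p : Pt d × Pt d => k p.1 p.2) {lam : ℝ} (hlam : 0 < lam) (T : ℕ) :
    IsGreatest (infoGains k X lam T) (maxInfoGain k X lam T) := by
  obtain ⟨x, hx⟩ := hXne
  have hc : IsCompact (Set.pi univ fun _ : Fin T => X ×ˢ X) :=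
    isCompact_univ_pi fun _ => hXc.prod hXc
  obtain ⟨w, hw, hmax⟩ := hc.exists_isMaxOn ⟨fun _ => (x, x), fun _ _ => ⟨hx, hx⟩⟩
    (continuous_infoGain hH hkc hlam T).continuousOn
  have hg : IsGreatest (infoGains k X lam T) (infoGain k lam w) := by
    refine ⟨⟨w, fun i => hw i (mem_univ i), rfl⟩, ?_⟩
    rintro _ ⟨v, hv, rfl⟩
    exact hmax (show v ∈ Set.pi univ fun _ : Fin T => X ×ˢ X from fun i _ => hv i)
  rw [maxInfoGain, hg.csSup_eq]
  exact hg

/-- Differences of a function over a sequence of pairs are controlled by the information gain,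
as long as each function is small in norm and on the previous pairs. -/
theorem sq_sum_sub_le_maxInfoGain (hXc : IsCompact X) (hXne : X.Nonempty) (hH : IsRKHSOf H k)
    (hk1 : ∀ x ∈ X, ∀ y ∈ X, k x y ≤ 1)
    (hkc : Continuous fun p : Pt d × Pt d => k p.1 p.2) {lam : ℝ} (hlam : 0 < lam) (T : ℕ)
    (w : ℕ → Pt d × Pt d) (hw : ∀ n < T, w n ∈ X ×ˢ X) (h : ℕ → H) {M : ℝ} (hM : 0 ≤ M)
    (hh : ∀ n < T, 2 * ‖h n‖ ^ 2
      + lam⁻¹ * ∑ i ∈ Finset.range n, (h n (w i).1 - h n (w i).2) ^ 2 ≤ M) :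
    (∑ n ∈ Finset.range T, (h n (w n).1 - h n (w n).2)) ^ 2
      ≤ 2 * (lam + 2) * M * maxInfoGain k X lam T * T := by
  -- Pairing (h, -h) with the feature (k_x, k_x') gives h x - h x'; the price is the factor 2 in
  -- front of ‖h‖².
  set F : ℕ → WithLp 2 (H × H) := fun n => WithLp.toLp 2 (h n, -h n) with hF
  have hFi : ∀ n v, ⟪F n, pairFeature H v⟫ = h n v.1 - h n v.2 := by
    intro n v
    rw [hF, pairFeature, WithLp.prod_inner_apply]
    change ⟪h n, kerAt H v.1⟫ + ⟪-h n, kerAt H v.2⟫ = _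
    rw [inner_neg_left, real_inner_comm, inner_kerAt, real_inner_comm, inner_kerAt,
      sub_eq_add_neg]
  have hFn : ∀ n, ‖F n‖ ^ 2 = 2 * ‖h n‖ ^ 2 := by
    intro n
    rw [hF, WithLp.prod_norm_sq_eq_of_L2]
    change ‖h n‖ ^ 2 + ‖-h n‖ ^ 2 = _
    rw [norm_neg]
    ring
  have key := sq_sum_inner_le_log_det (fun n => pairFeature H (w n)) F hlam T hM
    (fun n hn => norm_pairFeature_sq_le hH hk1 (hw n hn))
    (fun n hn => by rw [hFn]; simp only [hFi]; exact hh n hn)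
  simp only [hFi] at key
  -- The log-determinant is twice the gain, whence the leading 2 in the conclusion; lam + 2 comes
  -- from the bound 2 on the squared feature norm.
  have hgain := (isGreatest_maxInfoGain hXc hXne hH hkc hlam T).2
    ⟨fun i : Fin T => w i, fun i => hw i i.2, rfl⟩
  rw [infoGain_eq_log_det_regGram hH] at hgain
  refine key.trans ?_
  have h0 : 0 ≤ T * (M * (lam + 2)) := by positivity
  have := mul_le_mul_of_nonneg_left hgain h0
  linarith

end Kernel

/-! ### The radii `β₁`, `β₂` and `β` -/

section Radii

variable {B : ℝ}

lemma two_le_constCL (hB : 0 ≤ B) : 2 ≤ constCL B := by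
  have h1 : Real.exp (-2 * B) ≤ 1 := Real.exp_le_one_iff.2 (by linarith)
  have h2 : 1 ≤ 2 / (1 + Real.exp (-2 * B)) := by
    rw [le_div_iff₀ (by positivity)]; linarith
  unfold constCL
  linarith

lemma constH_pos (B : ℝ) : 0 < constH B := by unfold constH sigUp; positivity

lemma beta1_nonneg (hB : 0 ≤ B) {N ε δ : ℝ} (hε : 0 ≤ ε) (t : ℕ) : 0 ≤ beta1 B N ε δ t := by
  have := two_le_constCL hB
  unfold beta1; positivity

lemma beta2_nonneg (hB : 0 ≤ B) {N ε δ : ℝ} (hε : 0 ≤ ε) (t : ℕ) : 0 ≤ beta2 B N ε δ t := by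
  have := two_le_constCL hB
  have := constH_pos B
  unfold beta2; positivity

/-- The only place where β enters the regret bound: β₂ and one copy of β₁ are nonnegative and are
dropped. -/
lemma beta1_le_mul_beta (hB : 0 ≤ B) {N ε δ : ℝ} (hε : 0 ≤ ε) (t : ℕ) :
    beta1 B N ε δ t ≤ dsigLow B ^ 2 * constH B * beta B N ε δ t := by
  have h1 := beta1_nonneg hB (N := N) (δ := δ) hε t
  have h2 := beta2_nonneg hB (N := N) (δ := δ) hε t
  have hκ : dsigLow B ^ 2 * constH B ≠ 0 := (mul_pos (pow_pos (dsigLow_pos B) 2) (constH_pos B)).ne'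
  unfold beta
  rw [← mul_assoc, mul_one_div_cancel hκ]
  linarith

/-- At ε = 1/T the linear term equals C_L ≥ 2. This lets additive constants be absorbed into
multiples of β₁. -/
lemma one_le_beta1 (hB : 0 ≤ B) {N δ : ℝ} {T : ℕ} (hT : 1 ≤ T) :
    1 ≤ beta1 B N (1 / T) δ T := by
  have hT0 : (T : ℝ) ≠ 0 := by positivity
  have h1 := two_le_constCL hB
  have e : constCL B * (1 / T) * T = constCL B := by field_simp
  unfold beta1
  rw [e]
  linarith [Real.sqrt_nonneg (32 * T * B ^ 2 * Real.log (Real.pi ^ 2 * T ^ 2 * N / (6 * δ)))]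

lemma nine_le_pi_sq : 9 ≤ Real.pi ^ 2 := by nlinarith [Real.pi_gt_three]

lemma pi_sq_le_twelve : Real.pi ^ 2 ≤ 12 := by nlinarith [Real.pi_lt_d2, Real.pi_pos]

/-- The extreme case is T = N = δ = 1, where π² ≥ 9 suffices. Besides a nonnegative logarithm it
yields 2A ≤ A⁴ in `beta1_le_two_mul`. -/
lemma three_halves_le_arg {N δ : ℝ} {T : ℕ} (hT : 1 ≤ T) (hN : 1 ≤ N) (hδ0 : 0 < δ)
    (hδ1 : δ ≤ 1) : 3 / 2 ≤ Real.pi ^ 2 * T ^ 2 * N / (6 * δ) := by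
  have hT1 : (1 : ℝ) ≤ T := by exact_mod_cast hT
  rw [le_div_iff₀ (by positivity)]
  have h1 : (9 : ℝ) * 1 * 1 ≤ Real.pi ^ 2 * T ^ 2 * N := by
    gcongr
    · exact nine_le_pi_sq
    · exact one_le_pow₀ hT1
  linarith

/-- Halving the confidence parameter and shortening the horizon at most doubles `β₁`. -/
lemma beta1_le_two_mul (hB : 0 ≤ B) {N ε δ η : ℝ} (hN : 1 ≤ N) (hε : 0 ≤ ε) (hδ0 : 0 < δ)
    (hδ1 : δ ≤ 1) (hη : δ / 2 ≤ η) {t T : ℕ} (ht : 1 ≤ t) (htT : t ≤ T) :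
    beta1 B N ε η t ≤ 2 * beta1 B N ε δ T := by
  have ht1 : (1 : ℝ) ≤ t := by exact_mod_cast ht
  have htT' : (t : ℝ) ≤ T := by exact_mod_cast htT
  have hη0 : 0 < η := by linarith
  set A := Real.pi ^ 2 * T ^ 2 * N / (6 * δ) with hA
  have hA1 : 3 / 2 ≤ A := three_halves_le_arg (ht.trans htT) hN hδ0 hδ1
  -- Halving δ doubles the argument, and 2A ≤ A⁴ because A³ ≥ 27/8. The exponent 4 leaves the
  -- logarithm as a factor and the square root as 2.
  have hle : Real.pi ^ 2 * t ^ 2 * N / (6 * η) ≤ A ^ 4 := by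
    calc Real.pi ^ 2 * t ^ 2 * N / (6 * η) ≤ Real.pi ^ 2 * T ^ 2 * N / (6 * (δ / 2)) := by gcongr
      _ = 2 * A := by rw [hA]; field_simp
      _ ≤ A ^ 4 := by
        have h3 : (3 / 2 : ℝ) ^ 3 ≤ A ^ 3 := pow_le_pow_left₀ (by norm_num) hA1 3
        have : A ^ 4 = A ^ 3 * A := by ring
        rw [this]
        exact mul_le_mul_of_nonneg_right (by norm_num at h3; linarith) (by linarith)
  have hlog : Real.log (Real.pi ^ 2 * t ^ 2 * N / (6 * η)) ≤ 4 * Real.log A := by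
    have := Real.log_le_log (by positivity) hle
    rwa [Real.log_pow] at this
  have hlogA : 0 ≤ Real.log A := Real.log_nonneg (by linarith)
  have hsq : √(32 * t * B ^ 2 * Real.log (Real.pi ^ 2 * t ^ 2 * N / (6 * η)))
      ≤ 2 * √(32 * T * B ^ 2 * Real.log A) := by
    calc _ ≤ √(2 ^ 2 * (32 * T * B ^ 2 * Real.log A)) := by
          apply Real.sqrt_le_sqrt
          calc _ ≤ 32 * t * B ^ 2 * (4 * Real.log A) := by gcongr
            _ ≤ 32 * T * B ^ 2 * (4 * Real.log A) := by gcongr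
            _ = _ := by ring
      _ = _ := by rw [Real.sqrt_mul (by norm_num), Real.sqrt_sq (by norm_num)]
  have hCL := two_le_constCL hB
  have h2 : constCL B * ε * t ≤ constCL B * ε * T := by gcongr
  have h3 : 0 ≤ constCL B * ε * T := by positivity
  unfold beta1
  linarith

variable (B) in
/-- The constant in the order of `β_T`. -/
noncomputable def betaOrder : ℝ :=
  1 / (dsigLow B ^ 2 * constH B) *
    (8 * constH B * dsigUp ^ 2 + 2 * constCL B + √(32 * constBp B ^ 2)
      + 2 * (√(96 * B ^ 2) + constCL B))

/-- With Q = TN/δ, both logarithms have arguments below a power of Q, by π² ≤ 12 and 2 ≤ Q, and the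
remaining constants are absorbed by T log Q ≥ 1. For T = N = 1 and δ near 1 the right side would
degenerate to 0, hence T ≥ 2. -/
lemma beta_le_betaOrder_mul (hB : 0 ≤ B) {N δ : ℝ} (hN : 1 ≤ N) (hδ0 : 0 < δ)
    (hδ1 : δ ≤ 1) {T : ℕ} (hT : 2 ≤ T) :
    beta B N (1 / T) δ T ≤ betaOrder B * √(T * Real.log (T * N / δ)) := by
  have hT2 : (2 : ℝ) ≤ T := by exact_mod_cast hT
  set Q := T * N / δ with hQ
  have hTQ : (T : ℝ) ≤ Q := by
    rw [hQ, le_div_iff₀ hδ0]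
    have : (T : ℝ) * δ ≤ T * 1 := by gcongr
    have : (T : ℝ) * 1 ≤ T * N := by gcongr
    linarith
  have hQ2 : 2 ≤ Q := hT2.trans hTQ
  have hTTQ : (T : ℝ) ^ 2 * N / δ ≤ Q ^ 2 := by
    have : (T : ℝ) ^ 2 * N / δ = T * Q := by rw [hQ]; ring
    rw [this, sq]
    gcongr
  have hL : 1 / 2 ≤ Real.log Q := by
    have h1 := Real.log_le_log (by norm_num) hQ2
    have h2 := Real.log_two_gt_d9
    linarith
  have hTL : 1 ≤ T * Real.log Q := by nlinarith
  have hs : 1 ≤ √(T * Real.log Q) := Real.one_le_sqrt.2 hTL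
  have hA : Real.log (Real.pi ^ 2 * T ^ 2 * N / (6 * δ)) ≤ 3 * Real.log Q := by
    have h : Real.pi ^ 2 * T ^ 2 * N / (6 * δ) ≤ Q ^ 3 := by
      calc Real.pi ^ 2 * T ^ 2 * N / (6 * δ) ≤ 12 * T ^ 2 * N / (6 * δ) := by
            gcongr; exact pi_sq_le_twelve
        _ = 2 * (T ^ 2 * N / δ) := by field_simp; norm_num
        _ ≤ Q * Q ^ 2 := by gcongr
        _ = _ := by ring
    have := Real.log_le_log (by positivity) h
    rwa [Real.log_pow] at this
  have hA' : Real.log (Real.pi ^ 2 * T ^ 2 * N / (3 * δ)) ≤ 4 * Real.log Q := by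
    have h : Real.pi ^ 2 * T ^ 2 * N / (3 * δ) ≤ Q ^ 4 := by
      calc Real.pi ^ 2 * T ^ 2 * N / (3 * δ) ≤ 12 * T ^ 2 * N / (3 * δ) := by
            gcongr; exact pi_sq_le_twelve
        _ = 2 ^ 2 * (T ^ 2 * N / δ) := by field_simp; norm_num
        _ ≤ Q ^ 2 * Q ^ 2 := by gcongr
        _ = _ := by ring
    have := Real.log_le_log (by positivity) h
    rwa [Real.log_pow] at this
  have hs1 : √(32 * T * B ^ 2 * Real.log (Real.pi ^ 2 * T ^ 2 * N / (6 * δ)))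
      ≤ √(96 * B ^ 2) * √(T * Real.log Q) := by
    rw [← Real.sqrt_mul (by positivity)]
    apply Real.sqrt_le_sqrt
    calc _ ≤ 32 * T * B ^ 2 * (3 * Real.log Q) := by gcongr
      _ = _ := by ring
  have hs2 : √(8 * T * constBp B ^ 2 * Real.log (Real.pi ^ 2 * T ^ 2 * N / (3 * δ)))
      ≤ √(32 * constBp B ^ 2) * √(T * Real.log Q) := by
    rw [← Real.sqrt_mul (by positivity)]
    apply Real.sqrt_le_sqrt
    calc _ ≤ 8 * T * constBp B ^ 2 * (4 * Real.log Q) := by gcongr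
      _ = _ := by ring
  have hCL := two_le_constCL hB
  have hH := constH_pos B
  have hd : 0 ≤ 1 / (dsigLow B ^ 2 * constH B) := by positivity
  have e1 : constCL B * (1 / T) * T = constCL B := by field_simp
  have e2 : 2 * constCL B * (1 / T) * T = 2 * constCL B := by field_simp
  have e3 : 8 * constH B * dsigUp ^ 2 * (1 / T) ^ 2 * T ≤ 8 * constH B * dsigUp ^ 2 := by
    rw [mul_assoc]
    refine mul_le_of_le_one_right (by positivity) ?_
    have : (1 / (T : ℝ)) ^ 2 * T = 1 / T := by field_simp
    rw [this, div_le_one (by positivity)]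
    linarith
  have hc1 : constCL B ≤ constCL B * √(T * Real.log Q) :=
    le_mul_of_one_le_right (by linarith) hs
  have hc2 : 8 * constH B * dsigUp ^ 2 ≤ 8 * constH B * dsigUp ^ 2 * √(T * Real.log Q) :=
    le_mul_of_one_le_right (by positivity) hs
  unfold beta betaOrder
  rw [mul_assoc]
  refine mul_le_mul_of_nonneg_left ?_ hd
  unfold beta1 beta2
  rw [e1, e2]
  nlinarith

/-- The Basel sum: failure probabilities 6η/(π²t²) add up to at most η over all times. -/
lemma sum_inv_sq_le (T : ℕ) : ∑ t ∈ Finset.Icc 1 T, 6 / (Real.pi ^ 2 * (t : ℝ) ^ 2) ≤ 1 := by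
  have h := sum_le_hasSum (Finset.Icc 1 T) (fun n _ => by positivity) hasSum_zeta_two
  calc ∑ t ∈ Finset.Icc 1 T, 6 / (Real.pi ^ 2 * (t : ℝ) ^ 2)
      = 6 / Real.pi ^ 2 * ∑ t ∈ Finset.Icc 1 T, 1 / (t : ℝ) ^ 2 := by
        rw [Finset.mul_sum]
        exact Finset.sum_congr rfl fun t _ => by rw [div_mul_div_comm, mul_one]
    _ ≤ 6 / Real.pi ^ 2 * (Real.pi ^ 2 / 6) := by gcongr
    _ = 1 := by field_simp

end Radii

/-! ### Runs on which the likelihood ratios concentrate -/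

lemma sum_Icc_one_eq_sum_range (F : ℕ → ℝ) (n : ℕ) :
    ∑ t ∈ Finset.Icc 1 n, F t = ∑ i ∈ Finset.range n, F (i + 1) := by
  induction n with
  | zero => simp
  | succ n ih => rw [Finset.sum_Icc_succ_top (by omega), ih, Finset.sum_range_succ]

/-- The threshold for the noise in the log-likelihood ratios: the first term of `β₁`. -/
noncomputable def noiseBound (B N η : ℝ) (t : ℕ) : ℝ :=
  √(32 * t * B ^ 2 * Real.log (Real.pi ^ 2 * t ^ 2 * N / (6 * η)))

section Run

variable {d : ℕ} {H : Type*} [NormedAddCommGroup H] [InnerProductSpace ℝ H] [CompleteSpace H]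
  [RKHS ℝ H (Pt d) ℝ] {k : Pt d → Pt d → ℝ} {X : Set (Pt d)} {B : ℝ}

/-- The noise in the log-likelihood ratio of `g` against the utility `f`, up to time `t`. -/
noncomputable def ratioNoise (f g : Pt d → ℝ) (x x' : ℕ → Pt d) (o : ℕ → Bool) (t : ℕ) : ℝ :=
  ∑ τ ∈ Finset.Icc 1 t, ((if o τ then 1 else 0) - Real.sigmoid (f (x τ) - f (x' τ)))
    * ((g (x τ) - g (x' τ)) - (f (x τ) - f (x' τ)))

/-- The event on which all functions of the ball are `ε`-close to a function of the ball whose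
log-likelihood ratio against `f` has small noise. -/
def Concentrates (X : Set (Pt d)) (B N ε η : ℝ) (T : ℕ) (f : H) (x x' : ℕ → Pt d)
    (o : ℕ → Bool) : Prop :=
  ∀ g : H, ‖g‖ ≤ B → ∃ c : H, ‖c‖ ≤ B ∧ (∀ z ∈ X, |g z - c z| ≤ ε) ∧
    ∀ t ∈ Finset.Icc 1 T, ratioNoise (fun z => f z) (fun z => c z) x x' o t ≤ noiseBound B N η t

/-- Passing from g to its approximant c costs at most 2ε per duel, which C_L ≥ 2 covers. For c the
noise is controlled and the drift, having the right sign, is discarded. Applied to the maximum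
likelihood estimator, this puts f into the confidence set. -/
lemma logLik_le_add_beta1 (hB : 0 ≤ B) (hH : IsRKHSOf H k)
    (hk1 : ∀ x ∈ X, ∀ y ∈ X, k x y ≤ 1) {N ε η : ℝ} (hε : 0 ≤ ε) {T : ℕ} {f : H} (hf : ‖f‖ ≤ B)
    {x x' : ℕ → Pt d} {o : ℕ → Bool} (hx : ∀ t ∈ Finset.Icc 1 T, x t ∈ X)
    (hx' : ∀ t ∈ Finset.Icc 1 T, x' t ∈ X) (hc : Concentrates X B N ε η T f x x' o)
    {g : H} (hg : ‖g‖ ≤ B) {t : ℕ} (ht : t ∈ Finset.Icc 1 T) :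
    logLik (fun z => g z) x x' o t ≤ logLik (fun z => f z) x x' o t + beta1 B N ε η t := by
  obtain ⟨c, hcB, hgc, hn⟩ := hc g hg
  have hsub : ∀ τ ∈ Finset.Icc 1 t, τ ∈ Finset.Icc 1 T := fun τ hτ =>
    Finset.Icc_subset_Icc_right (Finset.mem_Icc.1 ht).2 hτ
  have h1 := logLik_sub_le hB (fun z => f z) (fun z => c z) x x' o t
    (fun τ hτ => abs_apply_sub_le hH hk1 (hx τ (hsub τ hτ)) (hx' τ (hsub τ hτ)) hf)
    (fun τ hτ => abs_apply_sub_le hH hk1 (hx τ (hsub τ hτ)) (hx' τ (hsub τ hτ)) hcB)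
  have h2 := (abs_le.1 (abs_logLik_sub_le (ε := ε) (fun z => g z) (fun z => c z) x x' o t
    (fun τ hτ => hgc _ (hx τ (hsub τ hτ))) (fun τ hτ => hgc _ (hx' τ (hsub τ hτ))))).2
  have h3 := hn t ht
  have h4 : 0 ≤ dsigLow B ^ 2 / 2 * ∑ τ ∈ Finset.Icc 1 t,
      ((c (x τ) - c (x' τ)) - (f (x τ) - f (x' τ))) ^ 2 :=
    mul_nonneg (by positivity) (Finset.sum_nonneg fun _ _ => sq_nonneg _)
  have h5 : 2 * ε * t ≤ constCL B * ε * t := by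
    have := two_le_constCL hB
    gcongr
  unfold beta1
  unfold noiseBound at h3
  unfold ratioNoise at h3
  linarith

/-- The same comparison with the drift kept: if g is at most β₁ less likely than f, the drift of c
is at most 2β₁, so its squares sum to at most 4β₁/σ'². Returning to g through (D + e)² ≤ 2D² + 2e²
with |e| ≤ 2ε doubles this and adds 8ε²t. -/
lemma sum_sq_le_of_logLik_ge (hB : 0 ≤ B) (hH : IsRKHSOf H k)
    (hk1 : ∀ x ∈ X, ∀ y ∈ X, k x y ≤ 1) {N ε η : ℝ} (hε : 0 ≤ ε) {T : ℕ} {f : H} (hf : ‖f‖ ≤ B)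
    {x x' : ℕ → Pt d} {o : ℕ → Bool} (hx : ∀ t ∈ Finset.Icc 1 T, x t ∈ X)
    (hx' : ∀ t ∈ Finset.Icc 1 T, x' t ∈ X) (hc : Concentrates X B N ε η T f x x' o)
    {g : H} (hg : ‖g‖ ≤ B) {t : ℕ} (ht : t ∈ Finset.Icc 1 T)
    (hl : logLik (fun z => f z) x x' o t - beta1 B N ε η t ≤ logLik (fun z => g z) x x' o t) :
    ∑ τ ∈ Finset.Icc 1 t, ((g (x τ) - g (x' τ)) - (f (x τ) - f (x' τ))) ^ 2
      ≤ 8 / dsigLow B ^ 2 * beta1 B N ε η t + 8 * ε ^ 2 * t := by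
  obtain ⟨c, hcB, hgc, hn⟩ := hc g hg
  have hsub : ∀ τ ∈ Finset.Icc 1 t, τ ∈ Finset.Icc 1 T := fun τ hτ =>
    Finset.Icc_subset_Icc_right (Finset.mem_Icc.1 ht).2 hτ
  have h1 := logLik_sub_le hB (fun z => f z) (fun z => c z) x x' o t
    (fun τ hτ => abs_apply_sub_le hH hk1 (hx τ (hsub τ hτ)) (hx' τ (hsub τ hτ)) hf)
    (fun τ hτ => abs_apply_sub_le hH hk1 (hx τ (hsub τ hτ)) (hx' τ (hsub τ hτ)) hcB)
  have h2 := (abs_le.1 (abs_logLik_sub_le (ε := ε) (fun z => g z) (fun z => c z) x x' o t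
    (fun τ hτ => hgc _ (hx τ (hsub τ hτ))) (fun τ hτ => hgc _ (hx' τ (hsub τ hτ))))).2
  have h3 := hn t ht
  have h5 : 2 * ε * t ≤ constCL B * ε * t := by
    have := two_le_constCL hB
    gcongr
  have h6 : dsigLow B ^ 2 / 2 * ∑ τ ∈ Finset.Icc 1 t,
      ((c (x τ) - c (x' τ)) - (f (x τ) - f (x' τ))) ^ 2 ≤ 2 * beta1 B N ε η t := by
    have e : beta1 B N ε η t = noiseBound B N η t + constCL B * ε * t := rfl
    unfold ratioNoise at h3
    linarith
  have hd := dsigLow_pos B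
  have h7 : ∑ τ ∈ Finset.Icc 1 t, ((c (x τ) - c (x' τ)) - (f (x τ) - f (x' τ))) ^ 2
      ≤ 4 / dsigLow B ^ 2 * beta1 B N ε η t := by
    rw [div_mul_eq_mul_div, le_div_iff₀ (by positivity)]
    linarith
  calc ∑ τ ∈ Finset.Icc 1 t, ((g (x τ) - g (x' τ)) - (f (x τ) - f (x' τ))) ^ 2
      ≤ ∑ τ ∈ Finset.Icc 1 t,
          (2 * ((c (x τ) - c (x' τ)) - (f (x τ) - f (x' τ))) ^ 2 + 8 * ε ^ 2) := by
        refine Finset.sum_le_sum fun τ hτ => ?_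
        have ha := abs_le.1 (hgc _ (hx τ (hsub τ hτ)))
        have hb := abs_le.1 (hgc _ (hx' τ (hsub τ hτ)))
        set a := g (x τ) - c (x τ)
        set b := g (x' τ) - c (x' τ)
        set D := (c (x τ) - c (x' τ)) - (f (x τ) - f (x' τ)) with hD
        have e : (g (x τ) - g (x' τ)) - (f (x τ) - f (x' τ)) = D + (a - b) := by
          simp only [hD, a, b]; ring
        have hab : (a - b) ^ 2 ≤ (2 * ε) ^ 2 := sq_le_sq' (by linarith) (by linarith)
        rw [e]
        nlinarith [sq_nonneg (D - (a - b))]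
    _ = 2 * ∑ τ ∈ Finset.Icc 1 t, ((c (x τ) - c (x' τ)) - (f (x τ) - f (x' τ))) ^ 2
          + 8 * ε ^ 2 * t := by
        rw [Finset.sum_add_distrib, ← Finset.mul_sum]
        simp; ring
    _ ≤ 2 * (4 / dsigLow B ^ 2 * beta1 B N ε η t) + 8 * ε ^ 2 * t := by gcongr
    _ = _ := by ring

/-- The constant in the regret bound. -/
noncomputable def regretConst (B lam : ℝ) : ℝ :=
  √(2 * (lam + 2) * (8 * B ^ 2 + lam⁻¹ * (16 / dsigLow B ^ 2 + 8))
    * (dsigLow B ^ 2 * constH B))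

omit [CompleteSpace H] in
lemma IsRun.mem_of_mem_Icc {ε η : ℝ} {T : ℕ} {x x' : ℕ → Pt d} {o : ℕ → Bool} {mle : ℕ → H}
    (hr : IsRun X B ε η T x x' o mle) : ∀ t ≤ T, x t ∈ X := by
  intro t ht
  rcases Nat.eq_zero_or_pos t with rfl | h
  · exact hr.init
  · exact (hr.optimistic t (Finset.mem_Icc.2 ⟨h, ht⟩)).1

omit [CompleteSpace H] in
lemma IsRun.reference_mem {ε η : ℝ} {T : ℕ} {x x' : ℕ → Pt d} {o : ℕ → Bool} {mle : ℕ → H}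
    (hr : IsRun X B ε η T x x' o mle) : ∀ t ∈ Finset.Icc 1 T, x' t ∈ X := by
  intro t ht
  rw [hr.reference t ht]
  rw [Finset.mem_Icc] at ht
  exact hr.mem_of_mem_Icc _ (by omega)

/-- The regret bound for a run on which the likelihood ratios concentrate. -/
theorem regret_le_of_concentrates (hB : 0 ≤ B) {lam : ℝ} (hlam : 0 < lam) (hXc : IsCompact X)
    (hXne : X.Nonempty) (hH : IsRKHSOf H k) (hk1 : ∀ x ∈ X, ∀ y ∈ X, k x y ≤ 1)
    (hkc : Continuous fun p : Pt d × Pt d => k p.1 p.2) {T : ℕ} (hT : 1 ≤ T) {δ η : ℝ}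
    (hδ0 : 0 < δ) (hδ1 : δ ≤ 1) (hη : δ / 2 ≤ η) {f : H} (hf : ‖f‖ ≤ B) {xstar : Pt d}
    (hxs : xstar ∈ X) {x x' : ℕ → Pt d} {o : ℕ → Bool} {mle : ℕ → H}
    (hr : IsRun X B (1 / T) η T x x' o mle)
    (hc : Concentrates X B (covNum H X B (1 / T)).toNat (1 / T) η T f x x' o) :
    regret (fun z => f z) xstar x T
      ≤ regretConst B lam * √(beta B (covNum H X B (1 / T)).toNat (1 / T) δ T
          * maxInfoGain k X lam T * T) := by
  have hT0 : (0 : ℝ) < T := by exact_mod_cast hT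
  have hε0 : (0 : ℝ) < 1 / T := by positivity
  set N : ℝ := ((covNum H X B (1 / T)).toNat : ℝ) with hN
  have hN1 : 1 ≤ N := by
    exact Nat.one_le_cast.2 (one_le_covNum_toNat hB (covNum_ne_top hXc hH hk1 hkc hε0))
  have hx : ∀ t ∈ Finset.Icc 1 T, x t ∈ X := fun t ht =>
    hr.mem_of_mem_Icc t (Finset.mem_Icc.1 ht).2
  have hx' := hr.reference_mem
  -- At t = 0 the set is the whole ball, so `mle 0`, which is unconstrained, plays no role.
  have hmem : ∀ t < T, f ∈ confSet X B (1 / T) η x x' o (mle t) t := by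
    intro t ht
    unfold confSet
    split_ifs with h0
    · exact hf
    · have htm : t ∈ Finset.Icc 1 T := Finset.mem_Icc.2 ⟨by omega, by omega⟩
      refine ⟨hf, ?_⟩
      have := logLik_le_add_beta1 hB hH hk1 hε0.le hf hx hx' hc (hr.mle_mem t htm) htm
      linarith
  -- Optimism: (xstar, f) is an admissible competitor in step n + 1. Subtracting the advantage of f
  -- in the duel will bound the regret by the advantage of g - f.
  have hopt : ∀ n < T, ∃ g ∈ confSet X B (1 / T) η x x' o (mle n) n,
      f xstar - f (x' (n + 1)) ≤ g (x (n + 1)) - g (x' (n + 1)) := by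
    intro n hn
    obtain ⟨-, g, hg, hmax⟩ := hr.optimistic (n + 1) (Finset.mem_Icc.2 ⟨by omega, by omega⟩)
    exact ⟨g, hg, hmax xstar hxs f (hmem n hn)⟩
  choose! g hg hgopt using hopt
  have hb1 : 1 ≤ beta1 B N (1 / T) δ T := one_le_beta1 hB hT
  set β₁ := beta1 B N (1 / T) δ T with hβ₁
  have hd := dsigLow_pos B
  have hgB : ∀ n < T, ‖g n‖ ≤ B := by
    intro n hn
    have := hg n hn
    unfold confSet at this
    split_ifs at this
    · exact this
    · exact this.1
  have hsum : ∀ n < T, ∑ τ ∈ Finset.Icc 1 n,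
      ((g n (x τ) - g n (x' τ)) - (f (x τ) - f (x' τ))) ^ 2 ≤ (16 / dsigLow B ^ 2 + 8) * β₁ := by
    intro n hn
    rcases Nat.eq_zero_or_pos n with rfl | hn0
    · simp only [Finset.Icc_eq_empty (by norm_num : ¬ (1 ≤ 0)), Finset.sum_empty]
      positivity
    have htm : n ∈ Finset.Icc 1 T := Finset.mem_Icc.2 ⟨hn0, hn.le⟩
    have hgn := hg n hn
    unfold confSet at hgn
    rw [if_neg hn0.ne'] at hgn
    -- The estimator is at least as likely as f, so g, within β₁ of the estimator, is at most β₁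
    -- less likely than f.
    have hmle := hr.mle_max n htm f hf
    have h1 := sum_sq_le_of_logLik_ge hB hH hk1 hε0.le hf hx hx' hc (hgB n hn) htm
      (by linarith [hgn.2])
    have h2 : beta1 B N (1 / T) η n ≤ 2 * β₁ :=
      beta1_le_two_mul hB hN1 hε0.le hδ0 hδ1 hη hn0 hn.le
    have h3 : (1 / (T : ℝ)) ^ 2 * n ≤ 1 := by
      have hnT : (n : ℝ) ≤ T := by exact_mod_cast hn.le
      have hT1 : (1 : ℝ) ≤ T := by exact_mod_cast hT
      calc (1 / (T : ℝ)) ^ 2 * (n : ℝ) ≤ (1 / (T : ℝ)) ^ 2 * (T : ℝ) := by gcongr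
        _ = 1 / (T : ℝ) := by field_simp
        _ ≤ 1 := by rw [div_le_one hT0]; exact hT1
    calc _ ≤ _ := h1
      _ ≤ 8 / dsigLow B ^ 2 * (2 * β₁) + 8 * β₁ := by
          refine add_le_add (mul_le_mul_of_nonneg_left h2 (by positivity)) ?_
          linarith
      _ = _ := by ring
  -- The part 8B² covers 2‖g - f‖² with ‖g - f‖ ≤ 2B, using β₁ ≥ 1; the rest is the error on past
  -- duels, weighted by λ⁻¹.
  set M := (8 * B ^ 2 + lam⁻¹ * (16 / dsigLow B ^ 2 + 8)) * β₁ with hM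
  have key := sq_sum_sub_le_maxInfoGain hXc hXne hH hk1 hkc hlam T
    (fun n => (x (n + 1), x' (n + 1)))
    (fun n hn => ⟨hx _ (Finset.mem_Icc.2 ⟨by omega, by omega⟩),
      hx' _ (Finset.mem_Icc.2 ⟨by omega, by omega⟩)⟩)
    (fun n => g n - f) (M := M) (by positivity) (fun n hn => by
      have h1 : ‖g n - f‖ ≤ 2 * B := (norm_sub_le _ _).trans (by linarith [hgB n hn])
      have h2 : ‖g n - f‖ ^ 2 ≤ (2 * B) ^ 2 := pow_le_pow_left₀ (norm_nonneg _) h1 2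
      have h3 : 2 * ‖g n - f‖ ^ 2 ≤ 8 * B ^ 2 * β₁ := by
        have : 8 * B ^ 2 * 1 ≤ 8 * B ^ 2 * β₁ := by gcongr
        linarith
      have h4 := hsum n hn
      rw [sum_Icc_one_eq_sum_range] at h4
      have h5 := mul_le_mul_of_nonneg_left h4 (inv_pos.2 hlam).le
      have e : ∀ i, ((g n - f : H) (x (i + 1)) - (g n - f : H) (x' (i + 1)))
          = (g n (x (i + 1)) - g n (x' (i + 1))) - (f (x (i + 1)) - f (x' (i + 1))) := by
        intro i
        simp only [RKHS.coe_sub, Pi.sub_apply]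
        ring
      simp only [e]
      rw [hM]
      linarith)
  have hreg : regret (fun z => f z) xstar x T
      ≤ ∑ n ∈ Finset.range T, ((g n - f : H) (x (n + 1)) - (g n - f : H) (x' (n + 1))) := by
    rw [regret, sum_Icc_one_eq_sum_range]
    refine Finset.sum_le_sum fun n hn => ?_
    have := hgopt n (Finset.mem_range.1 hn)
    simp only [RKHS.coe_sub, Pi.sub_apply]
    linarith
  -- Read off from `key`: a positive multiple of this product dominates a square.
  have hγ : 0 ≤ maxInfoGain k X lam T * T := by
    have hpos : 0 ≤ 2 * (lam + 2) * M * (maxInfoGain k X lam T * T) := by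
      rw [← mul_assoc]; exact (sq_nonneg _).trans key
    have hM0 : 0 < 2 * (lam + 2) * M := by
      have : 0 < 16 / dsigLow B ^ 2 + 8 := by positivity
      positivity
    exact nonneg_of_mul_nonneg_right hpos hM0
  have hβ : β₁ ≤ dsigLow B ^ 2 * constH B * beta B N (1 / T) δ T := beta1_le_mul_beta hB hε0.le T
  refine hreg.trans ((Real.le_sqrt_of_sq_le key).trans ?_)
  rw [regretConst, ← Real.sqrt_mul (by have := constH_pos B; positivity)]
  apply Real.sqrt_le_sqrt
  calc 2 * (lam + 2) * M * maxInfoGain k X lam T * T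
      = 2 * (lam + 2) * (8 * B ^ 2 + lam⁻¹ * (16 / dsigLow B ^ 2 + 8)) * β₁
          * (maxInfoGain k X lam T * T) := by rw [hM]; ring
    _ ≤ 2 * (lam + 2) * (8 * B ^ 2 + lam⁻¹ * (16 / dsigLow B ^ 2 + 8))
          * (dsigLow B ^ 2 * constH B * beta B N (1 / T) δ T) * (maxInfoGain k X lam T * T) := by
        gcongr
    _ = _ := by ring

/-! ### Concentration of the likelihood ratios -/

variable {Ω : Type*} [mΩ : MeasurableSpace Ω] {μ : Measure Ω} {ℱ : Filtration ℕ mΩ}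

lemma IsOracle.isPredictableBernoulli (hH : IsRKHSOf H k)
    (hk1 : ∀ x ∈ X, ∀ y ∈ X, k x y ≤ 1)
    (hkc : Continuous fun p : Pt d × Pt d => k p.1 p.2) {T : ℕ} {f g : H} (hf : ‖f‖ ≤ B)
    (hg : ‖g‖ ≤ B) {x x' : ℕ → Ω → Pt d} {o : ℕ → Ω → Bool}
    (ho : IsOracle μ ℱ (fun z => f z) T x x' o)
    (hx : ∀ t ∈ Finset.Icc 1 T, ∀ ω, x t ω ∈ X) (hx' : ∀ t ∈ Finset.Icc 1 T, ∀ ω, x' t ω ∈ X) :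
    IsPredictableBernoulli μ ℱ T (4 * B) o
      (fun t ω => Real.sigmoid (f (x t ω) - f (x' t ω)))
      (fun t ω => (g (x t ω) - g (x' t ω)) - (f (x t ω) - f (x' t ω))) where
  meas_p t ht := by
    have h := (continuous_apply hH hkc f).measurable
    exact continuous_sigmoid.measurable.comp
      ((h.comp (ho.duel_left t ht)).sub (h.comp (ho.duel_right t ht)))
  meas_D t ht := by
    have h := (continuous_apply hH hkc f).measurable
    have h' := (continuous_apply hH hkc g).measurable
    exact ((h'.comp (ho.duel_left t ht)).sub (h'.comp (ho.duel_right t ht))).sub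
      ((h.comp (ho.duel_left t ht)).sub (h.comp (ho.duel_right t ht)))
  meas_o := ho.outcome
  p_nonneg _ _ := Real.sigmoid_nonneg _
  p_le_one _ _ := Real.sigmoid_le_one _
  abs_D_le t ht ω := by
    have h1 := abs_apply_sub_le hH hk1 (hx t ht ω) (hx' t ht ω) hf
    have h2 := abs_apply_sub_le hH hk1 (hx t ht ω) (hx' t ht ω) hg
    exact (abs_sub _ _).trans (by linarith)
  condExp_eq := ho.bernoulli

/-- Union bound over times and cover centres. With R = 4B the Chernoff threshold is exactly
`noiseBound`, and each pair (t, centre) fails with probability at most 6η/(π²t²n). -/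
theorem measure_concentrates_ge [IsProbabilityMeasure μ] (hB : 0 < B) (hH : IsRKHSOf H k)
    (hk1 : ∀ x ∈ X, ∀ y ∈ X, k x y ≤ 1)
    (hkc : Continuous fun p : Pt d × Pt d => k p.1 p.2) {T : ℕ} {ε η : ℝ} (hε : 0 ≤ ε)
    (hcov : covNum H X B ε ≠ ⊤) (hη0 : 0 < η) (hη1 : η ≤ 1) {f : H} (hf : ‖f‖ ≤ B)
    {x x' : ℕ → Ω → Pt d} {o : ℕ → Ω → Bool} (ho : IsOracle μ ℱ (fun z => f z) T x x' o)
    (hx : ∀ t ∈ Finset.Icc 1 T, ∀ ω, x t ω ∈ X) (hx' : ∀ t ∈ Finset.Icc 1 T, ∀ ω, x' t ω ∈ X) :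
    1 - η ≤ μ.real {ω | Concentrates X B (covNum H X B ε).toNat ε η T f
      (fun t => x t ω) (fun t => x' t ω) (fun t => o t ω)} := by
  have hcover := exists_cover_fball (B := B) (X := X) hε hcov
  have hN := one_le_covNum_toNat hB.le hcov
  set n := (covNum H X B ε).toNat with hn
  obtain ⟨c, hcB, hc⟩ := hcover
  have hN1 : (1 : ℝ) ≤ n := by exact_mod_cast hN
  set good := {ω | Concentrates X B n ε η T f
      (fun t => x t ω) (fun t => x' t ω) (fun t => o t ω)} with hgood
  set bad : ℕ × Fin n → Set Ω := fun q => {ω | noiseBound B n η q.1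
    ≤ ratioNoise (fun z => f z) (fun z => c q.2 z) (fun t => x t ω) (fun t => x' t ω)
      (fun t => o t ω) q.1} with hbad
  -- Covering the whole space, instead of taking complements, needs only monotonicity and
  -- subadditivity, so measurability of `good` is not required.
  have hcover : univ ⊆ good ∪ ⋃ q ∈ Finset.Icc 1 T ×ˢ (Finset.univ : Finset (Fin n)), bad q := by
    intro ω _
    by_contra hω
    rw [mem_union, not_or] at hω
    refine hω.1 fun g hg => ?_
    obtain ⟨i, hi⟩ := hc g hg
    refine ⟨c i, hcB i, hi, fun t ht => ?_⟩
    by_contra hlt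
    refine hω.2 (mem_iUnion₂.2 ⟨(t, i), Finset.mem_product.2 ⟨ht, Finset.mem_univ i⟩, ?_⟩)
    exact (not_le.1 hlt).le
  have hbadle : ∀ q ∈ Finset.Icc 1 T ×ˢ (Finset.univ : Finset (Fin n)),
      μ.real (bad q) ≤ 6 / (Real.pi ^ 2 * (q.1 : ℝ) ^ 2) * (η / n) := by
    rintro ⟨t, i⟩ hq
    have ht := (Finset.mem_product.1 hq).1
    obtain ⟨ht1, htT⟩ := Finset.mem_Icc.1 ht
    have ht0 : (0 : ℝ) < t := by exact_mod_cast ht1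
    have hA := three_halves_le_arg ht1 hN1 hη0 hη1
    have h := (ho.isPredictableBernoulli hH hk1 hkc hf (hcB i) hx hx').measure_noise_ge_le
      (by positivity) ht1 htT
      (l := Real.log (Real.pi ^ 2 * (t : ℝ) ^ 2 * n / (6 * η))) (Real.log_nonneg (by linarith))
    have e1 : √(2 * t * (4 * B) ^ 2 * Real.log (Real.pi ^ 2 * (t : ℝ) ^ 2 * n / (6 * η)))
        = noiseBound B n η t := by
      unfold noiseBound
      congr 1; ring
    rw [e1, Real.exp_neg, Real.exp_log (by linarith)] at h
    refine h.trans (le_of_eq ?_)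
    field_simp
  have htot : μ.real (⋃ q ∈ Finset.Icc 1 T ×ˢ (Finset.univ : Finset (Fin n)), bad q) ≤ η := by
    refine (measureReal_biUnion_finset_le _ _).trans ((Finset.sum_le_sum hbadle).trans ?_)
    rw [Finset.sum_product]
    simp only [Finset.sum_const, Finset.card_univ, Fintype.card_fin, nsmul_eq_mul]
    have e : ∀ t : ℕ, (n : ℝ) * (6 / (Real.pi ^ 2 * (t : ℝ) ^ 2) * (η / n))
        = 6 / (Real.pi ^ 2 * (t : ℝ) ^ 2) * η := by
      intro t
      have : (n : ℝ) ≠ 0 := by positivity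
      rw [mul_left_comm, mul_div_cancel₀ _ this]
    simp only [e]
    rw [← Finset.sum_mul]
    exact mul_le_of_le_one_left hη0.le (sum_inv_sq_le T)
  have h1 : 1 ≤ μ.real good
      + μ.real (⋃ q ∈ Finset.Icc 1 T ×ˢ (Finset.univ : Finset (Fin n)), bad q) := by
    calc (1 : ℝ) = μ.real univ := probReal_univ.symm
      _ ≤ μ.real (good ∪ ⋃ q ∈ Finset.Icc 1 T ×ˢ (Finset.univ : Finset (Fin n)), bad q) :=
          measureReal_mono hcover
      _ ≤ _ := measureReal_union_le _ _
  linarith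

end Run

end POPBO

/-! ### The regret theorem -/

theorem theorem5 (B lam : ℝ) (hB : 0 ≤ B) (hlam : 0 < lam) :
    ∃ C : ℝ, 0 < C ∧
      ∀ (d : ℕ) (X : Set (POPBO.Pt d)) (_hXc : IsCompact X) (_hXne : X.Nonempty)
        (k : POPBO.Pt d → POPBO.Pt d → ℝ) (_hpsd : (Matrix.of k).PosSemidef)
        (_hk1 : ∀ x ∈ X, ∀ y ∈ X, k x y ≤ 1)
        (_hkc : Continuous fun p : POPBO.Pt d × POPBO.Pt d => k p.1 p.2)
        (H : Type*) [NormedAddCommGroup H] [InnerProductSpace ℝ H] [CompleteSpace H]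
        [RKHS ℝ H (POPBO.Pt d) ℝ] (_hH : POPBO.IsRKHSOf H k)
        (T : ℕ) (_hT : 1 ≤ T) (δ : ℝ) (_hδ0 : 0 < δ) (_hδ1 : δ < 1),
        -- the covering number is finite and the maximal information gain is attained
        POPBO.covNum H X B (1 / T) ≠ ⊤ ∧
        IsGreatest (POPBO.infoGains k X lam T) (POPBO.maxInfoGain k X lam T) ∧
        -- the order of `β_T`
        (2 ≤ T →
          POPBO.beta B (POPBO.covNum H X B (1 / T)).toNat (1 / T) δ T
            ≤ C * Real.sqrt (T * Real.log (T * (POPBO.covNum H X B (1 / T)).toNat / δ))) ∧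
        -- the regret bound, for every objective and every run of the algorithm
        ∀ (f : H) (_hf : ‖f‖ ≤ B)
          (xstar : POPBO.Pt d) (_hxs : xstar ∈ X) (_hmax : IsMaxOn (fun z => f z) X xstar)
          (η : ℝ) (_hη : η ∈ Set.Icc (δ / 2) δ)
          (Ω : Type*) [mΩ : MeasurableSpace Ω] (μ : MeasureTheory.Measure Ω)
          [MeasureTheory.IsProbabilityMeasure μ] (ℱ : MeasureTheory.Filtration ℕ mΩ)
          (x x' : ℕ → Ω → POPBO.Pt d) (o : ℕ → Ω → Bool) (mle : ℕ → Ω → H)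
          (_horacle : POPBO.IsOracle μ ℱ (fun z => f z) T x x' o)
          (_hrun : ∀ ω, POPBO.IsRun X B (1 / T) η T
            (fun t => x t ω) (fun t => x' t ω) (fun t => o t ω) (fun t => mle t ω)),
          ENNReal.ofReal (1 - δ) ≤
            μ {ω | POPBO.regret (fun z => f z) xstar (fun t => x t ω) T
              ≤ C * Real.sqrt
                  (POPBO.beta B (POPBO.covNum H X B (1 / T)).toNat (1 / T) δ T
                    * POPBO.maxInfoGain k X lam T * T)} := by
  -- One constant for both claims: `betaOrder` serves the order of β_T, `regretConst` the regret,
  -- and 1 makes positivity immediate.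
  refine ⟨max (POPBO.betaOrder B) (max (POPBO.regretConst B lam) 1),
    lt_max_of_lt_right (lt_max_of_lt_right one_pos), ?_⟩
  intro d X hXc hXne k _ hk1 hkc H _ _ _ _ hH T hT δ hδ0 hδ1
  have hT0 : (0 : ℝ) < T := by exact_mod_cast hT
  have hε : (0 : ℝ) < 1 / T := by positivity
  have hcov := POPBO.covNum_ne_top (B := B) hXc hH hk1 hkc hε
  have hN : (1 : ℝ) ≤ (POPBO.covNum H X B (1 / T)).toNat := by
    exact_mod_cast POPBO.one_le_covNum_toNat hB hcov
  refine ⟨hcov, POPBO.isGreatest_maxInfoGain hXc hXne hH hkc hlam T, fun hT2 => ?_, ?_⟩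
  · exact (POPBO.beta_le_betaOrder_mul hB hN hδ0 hδ1.le hT2).trans
      (mul_le_mul_of_nonneg_right (le_max_left _ _) (Real.sqrt_nonneg _))
  intro f hf xstar hxs _ η hη Ω mΩ μ _ ℱ x x' o mle horacle hrun
  have hCle : POPBO.regretConst B lam
      ≤ max (POPBO.betaOrder B) (max (POPBO.regretConst B lam) 1) :=
    (le_max_left _ _).trans (le_max_right _ _)
  -- For B = 0 the ball is {0} and the regret vanishes; the Chernoff bound divides by R = 4B and
  -- needs B > 0.
  rcases hB.eq_or_lt with rfl | hBpos
  · have hf0 : f = 0 := norm_le_zero_iff.1 hf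
    refine (ENNReal.ofReal_le_one.2 (by linarith)).trans ?_
    rw [← measure_univ (μ := μ)]
    refine measure_mono fun ω _ => ?_
    have hreg : POPBO.regret (fun z => f z) xstar (fun t => x t ω) T = 0 := by
      simp [POPBO.regret, hf0]
    rw [mem_ofPred_eq, hreg]
    positivity
  have hη0 : 0 < η := by linarith [hη.1]
  have h := POPBO.measure_concentrates_ge hBpos hH hk1 hkc hε.le hcov hη0
    (hη.2.trans hδ1.le) hf horacle
    (fun t ht ω => (hrun ω).mem_of_mem_Icc t (Finset.mem_Icc.1 ht).2)
    (fun t ht ω => (hrun ω).reference_mem t ht)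
  refine (ENNReal.ofReal_le_of_le_toReal ((by linarith [hη.2] : 1 - δ ≤ 1 - η).trans h)).trans
    (measure_mono fun ω hω => ?_)
  exact (POPBO.regret_le_of_concentrates hB hlam hXc hXne hH hk1 hkc hT hδ0 hδ1.le hη.1 hf hxs
    (hrun ω) hω).trans (mul_le_mul_of_nonneg_right hCle (Real.sqrt_nonneg _))
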